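/- **Setting.** Let $p\ge 1$, let $D$ be the $(p+1)$-regular tree and let $\Gamma$ be a group of automorphisms of $D$ acting freely (no nonunit element fixes a vertex, no element inverts an edge). Put $T=D/\Gamma$, a $(p+1)$-valent graph (multiple edges and loops allowed) with oriented edges $\vec e$, opposite edges $\overleftarrow{e}$, start $d_0\vec e$ and end $d_1\vec e$. Let $F\subset T$ be a reduced graph, i.e. a finite nonempty connected subgraph containing every proper closed path of $T$ (closed path without backtracking, also at its closing point); its vertices and oriented edges are $V(F)$, $\vec E(F)$. Let $U_{\vec e}$ be elements of a group $\mathcal A$ with $U_{\overleftarrow e}=U_{\vec e}^{-1}$ (unitary potentials), and let $\rho$ be a representation of $\mathcal A$ on a finite-dimensional complex vector space $v$; write $U$ for $\rho(U)$. Put $r_0=\dim v\cdot|V(F)|$, $r_1=\dim v\cdot|\vec E(F)|/2$. On functions $f:V(F)\to v$ let $$\tilde\Delta(u)=I-u\tilde M_1+u^2Q,\quad (\tilde M_1f)(x)=\sum_{\vec e\in \vec E(F),\,d_0\vec e=x}U_{\vec e}f(d_1\vec e),\quad (Qf)(x)=(\#\{\vec e\in\vec E(F):d_0\vec e=x\}-1)f(x).$$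 Let $\partial F$ be the set of vertices of $F$ at which some edge of $T$ outside $F$ starts. For $\lambda\in\mathbb C$ let $\alpha_\pm$ be the two roots (with multiplicity, named in either order) of $p\alpha^2-(p+1+\lambda)\alpha+1=0$. A pair $v_\pm:\partial F\to v$ is called the pair of amplitudes of a scattering solution if there is $\psi:V(T)\to v$ with $\sum_{d_0\vec e=x}U_{\vec e}\psi(d_1\vec e)-(p+1)\psi(x)=\lambda\psi(x)$ for all $x\in V(T)$, and $\psi(y)=(U_{\vec e_1}\cdots U_{\vec e_n})^{-1}\bigl(\alpha_+^n v_+(x)-\alpha_-^n v_-(x)\bigr)$ for every path without backtracking $\vec e_1\dots\vec e_n$ ($n\ge 0$) of edges outside $F$ from a point $x\in\partial F$ to a vertex $y$. The Ihara–Selberg $L$-function $L(\rho,u)$ is the rational function which for all small $|u|$ is the convergent product $\prod_{\varpi}\det\bigl(I-u^{l(\varpi)}\rho(\varpi)\bigr)^{-1}$ over the proper closed oriented paths $\varpi=\vec e_1\dots\vec e_l$ of $T$ without subperiods, taken up to the choice of the starting point, with $l(\varpi)=l$ and $\rho(\varpi)=U_{\vec e_1}\cdots U_{\vec e_l}$.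 **Theorem.** The set $\{u:\det\tilde\Delta(u)=0\}$ is finite, and $L(\rho,u)$ exists and is unique. If $\det\tilde\Delta(\alpha_+)\ne0$, there is a linear operator $S$ on the space of functions $\partial F\to v$ such that $(v_+,v_-)$ is the pair of amplitudes of a scattering solution if and only if $v_+=Sv_-$, and $$\det S=\Bigl(\frac{\alpha_+}{\alpha_-}\Bigr)^{r_0}\frac{\det\tilde\Delta(\alpha_-)}{\det\tilde\Delta(\alpha_+)}.$$ If also $\det\tilde\Delta(\alpha_-)\ne0$, then $S$ is invertible, with inverse the operator $v_+\mapsto v_-$; and if moreover $\alpha_\pm^2\ne1$, then $$\det S=\Bigl(\frac{\alpha_+}{\alpha_-}\Bigr)^{r_0}\Bigl(\frac{1-\alpha_-^2}{1-\alpha_+^2}\Bigr)^{r_0-r_1}\frac{L(\rho,\alpha_+)}{L(\rho,\alpha_-)}.$$ -/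

import Mathlib

open Filter Topology

/-- A graph with oriented edges (multiple edges and loops allowed): every oriented edge `e` starts
at `d0 e`, and `rev` sends an oriented edge to the same edge with the opposite orientation. -/
structure OrientedGraph (V E : Type*) where
  d0 : E → V
  rev : E → E
  rev_rev : ∀ e, rev (rev e) = e
  rev_ne : ∀ e, rev e ≠ e

namespace OrientedGraph

variable {V E : Type*} (T : OrientedGraph V E)

/-- The vertex at which an oriented edge terminates. -/
def d1 (e : E) : V := T.d0 (T.rev e)

/-- `T.Follows e e'`: the edge `e'` starts where `e` terminates, and there is no backtracking. -/
def Follows (e e' : E) : Prop := T.d0 e' = T.d1 e ∧ e' ≠ T.rev e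

/-- `T.IsPath x l y`: `l` is the list of edges of a path without backtracking from `x` to `y`. -/
inductive IsPath : V → List E → V → Prop
  | nil (x : V) : IsPath x [] x
  | snoc {x : V} {l : List E} {e : E} : IsPath x l (T.d0 e) →
      (∀ e' ∈ l.getLast?, e ≠ T.rev e') → IsPath x (l ++ [e]) (T.d1 e)

/-- A proper closed path with the marked point forgotten: a nonempty cyclic word of oriented edges,
consecutive and without backtracking also across the closing point. -/
def IsProperClosedPath (c : Cycle E) : Prop := c ≠ Cycle.nil ∧ c.Chain T.Follows

/-- The cyclic word `c` has no subperiods. -/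
def HasNoPeriods (c : Cycle E) : Prop :=
  ¬ ∃ (l : List E) (n : ℕ), 2 ≤ n ∧ c = (((List.replicate n l).flatten : List E) : Cycle E)

/-- The proper closed paths without subperiods, up to the choice of the marked point. -/
def PrimitivePath : Type _ := {c : Cycle E // T.IsProperClosedPath c ∧ HasNoPeriods c}

/-- A finite subgraph: it contains the ends of its edges, and both orientations of each. -/
structure FinSubgraph where
  verts : Finset V
  edges : Finset E
  d0_mem : ∀ e ∈ edges, T.d0 e ∈ verts
  rev_mem : ∀ e ∈ edges, T.rev e ∈ edges

variable {T} in
theorem FinSubgraph.d1_mem (F : T.FinSubgraph) {e : E} (he : e ∈ F.edges) :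
    T.d1 e ∈ F.verts := F.d0_mem _ (F.rev_mem e he)

variable {T} in
/-- `F` is a reduced graph of `T`: a finite (nonempty) connected subgraph containing all loops. -/
structure FinSubgraph.IsReducedGraph (F : T.FinSubgraph) : Prop where
  nonempty : F.verts.Nonempty
  connected : ∀ x ∈ F.verts, ∀ y ∈ F.verts, ∃ l, T.IsPath x l y ∧ ∀ e ∈ l, e ∈ F.edges
  loops : ∀ c : Cycle E, T.IsProperClosedPath c → ∀ e ∈ c, e ∈ F.edges

variable {T} in
/-- The boundary points of `F`: those at which at least one external branch starts. -/
def FinSubgraph.boundary (F : T.FinSubgraph) : Set V :=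
  {x | x ∈ F.verts ∧ ∃ e, T.d0 e = x ∧ e ∉ F.edges}

end OrientedGraph

/-! ### Factorized trees -/

section Quotient

variable {X : Type*} {D : SimpleGraph X}

/-- The group `Γ` of motions of `D` acts freely: a nonunit element fixes no vertex, and no element
inverts an edge (which would give a fixed point in the middle of that edge). -/
structure ActsFreely (Γ : Subgroup (D ≃g D)) : Prop where
  no_fixed_vertex : ∀ γ ∈ Γ, γ ≠ 1 → ∀ x : X, γ x ≠ x
  no_inversion : ∀ γ ∈ Γ, ∀ x y : X, D.Adj x y → ¬ (γ x = y ∧ γ y = x)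

/-- Two vertices are identified when they lie in one `Γ`-orbit. -/
def vertexSetoid (Γ : Subgroup (D ≃g D)) : Setoid X where
  r x y := ∃ γ ∈ Γ, γ x = y
  iseqv :=
    { refl := fun _ => ⟨1, Γ.one_mem, rfl⟩
      symm := by
        rintro x y ⟨γ, hγ, rfl⟩
        exact ⟨γ⁻¹, Γ.inv_mem hγ, γ.symm_apply_apply x⟩
      trans := by
        rintro x y z ⟨γ, hγ, rfl⟩ ⟨δ, hδ, rfl⟩
        exact ⟨δ * γ, Γ.mul_mem hδ hγ, rfl⟩ }

/-- Two oriented edges are identified when they lie in one `Γ`-orbit. -/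
def edgeSetoid (Γ : Subgroup (D ≃g D)) : Setoid D.Dart where
  r e f := ∃ γ ∈ Γ, γ e.fst = f.fst ∧ γ e.snd = f.snd
  iseqv :=
    { refl := fun _ => ⟨1, Γ.one_mem, rfl, rfl⟩
      symm := by
        rintro e f ⟨γ, hγ, h1, h2⟩
        exact ⟨γ⁻¹, Γ.inv_mem hγ, by rw [← h1]; exact γ.symm_apply_apply _,
          by rw [← h2]; exact γ.symm_apply_apply _⟩
      trans := by
        rintro e f g ⟨γ, hγ, h1, h2⟩ ⟨δ, hδ, h3, h4⟩
        exact ⟨δ * γ, Γ.mul_mem hδ hγ, by rw [← h3, ← h1]; rfl, by rw [← h4, ← h2]; rfl⟩ }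

/-- The graph `D / Γ`. -/
def factorizedTree (Γ : Subgroup (D ≃g D)) (hΓ : ActsFreely Γ) :
    OrientedGraph (Quotient (vertexSetoid Γ)) (Quotient (edgeSetoid Γ)) where
  d0 := Quotient.map' (fun e : D.Dart => e.fst) (by
    rintro e f ⟨γ, hγ, h1, _⟩
    exact ⟨γ, hγ, h1⟩)
  rev := Quotient.map' (fun e : D.Dart => e.symm) (by
    rintro e f ⟨γ, hγ, h1, h2⟩
    exact ⟨γ, hγ, h2, h1⟩)
  rev_rev := by
    rintro ⟨e⟩
    rfl
  rev_ne := by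
    rintro ⟨e⟩ h
    obtain ⟨γ, hγ, h1, h2⟩ := Quotient.exact h
    exact hΓ.no_inversion γ hγ _ _ e.adj ⟨h2, h1⟩

end Quotient

/-! ### Potentials and operators

`U e` is the potential on the oriented edge `e`, an element of a group `A`, which acts through its
representation `ρ` on the space `v`. -/

namespace OrientedGraph

variable {V E A v : Type*} [Group A] [AddCommGroup v] [Module ℂ v]
variable (T : OrientedGraph V E)

/-- `(M₁ψ)(x) = ∑ U_e ψ(y)` over the oriented edges `e` from `x`, with `y` the end of `e`. -/
noncomputable def hecke (U : E → A) (ρ : Representation ℂ A v) (ψ : V → v) (x : V) : v :=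
  ∑ᶠ e : {e : E // T.d0 e = x}, ρ (U e) (ψ (T.d1 e))

/-- `Q + 1`: the number of ends of edges at the vertex `x`. -/
noncomputable def valency (x : V) : ℕ := Nat.card {e : E // T.d0 e = x}

/-- The Laplacian `M₁ - (Q + 1)` on the whole graph. -/
noncomputable def laplacian (U : E → A) (ρ : Representation ℂ A v) (ψ : V → v) (x : V) : v :=
  T.hecke U ρ ψ x - (T.valency x : ℂ) • ψ x

variable {T}

open Classical in
/-- The operator `M̃₁` of the subgraph `F`. -/
noncomputable def FinSubgraph.hecke (F : T.FinSubgraph) (U : E → A) (ρ : Representation ℂ A v) :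
    (F.verts → v) →ₗ[ℂ] (F.verts → v) :=
  LinearMap.pi fun x => ∑ e ∈ F.edges.attach with T.d0 e.1 = x,
    ρ (U e.1) ∘ₗ LinearMap.proj ⟨T.d1 e.1, F.d1_mem e.2⟩

open Classical in
/-- The operator `Q` of the subgraph `F`: (number of ends of edges of `F` at the vertex) - 1. -/
noncomputable def FinSubgraph.Q (F : T.FinSubgraph) (v : Type*) [AddCommGroup v] [Module ℂ v] :
    (F.verts → v) →ₗ[ℂ] (F.verts → v) :=
  LinearMap.pi fun x =>
    (((F.edges.filter fun e => T.d0 e = x).card : ℂ) - 1) • LinearMap.proj x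

/-- `Δ̃(u) = I - u M̃₁ + u² Q` on the subgraph `F`. -/
noncomputable def FinSubgraph.delta (F : T.FinSubgraph) (U : E → A) (ρ : Representation ℂ A v)
    (u : ℂ) : (F.verts → v) →ₗ[ℂ] (F.verts → v) :=
  LinearMap.id - u • F.hecke U ρ + u ^ 2 • F.Q v

/-- Dimension of the space of `v`-valued functions on the vertices of `F`. -/
noncomputable def FinSubgraph.r0 (F : T.FinSubgraph) (v : Type*) [AddCommGroup v] [Module ℂ v] :
    ℕ := Module.finrank ℂ (F.verts → v)

/-- Half the dimension of the space of `v`-valued functions on the oriented edges of `F`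
(the number of oriented edges is even, so the division is exact). -/
noncomputable def FinSubgraph.r1 (F : T.FinSubgraph) (v : Type*) [AddCommGroup v] [Module ℂ v] :
    ℕ := Module.finrank ℂ (F.edges → v) / 2

/-- `a` and `b` are the amplitudes of the `α₊`- and `α₋`-parts of a solution on the whole graph:
there is `ψ` with `Lψ = lam ψ` such that, at the end of each path of length `n` that starts at a
boundary point `x` of `F` and runs through the branches (edges outside `F`),
`ψ = (U₁ ⋯ Uₙ)⁻¹ (α₊ⁿ a(x) - α₋ⁿ b(x))`. -/
def FinSubgraph.IsScatteringSolution (F : T.FinSubgraph) (U : E → A) (ρ : Representation ℂ A v)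
    (lam αp αm : ℂ) (a b : F.boundary → v) : Prop :=
  ∃ ψ : V → v, (∀ x, T.laplacian U ρ ψ x = lam • ψ x) ∧
    ∀ (x : F.boundary) (l : List E) (y : V), T.IsPath x l y → (∀ e ∈ l, e ∉ F.edges) →
      ψ y = ρ (l.map U).prod⁻¹ (αp ^ l.length • a x - αm ^ l.length • b x)

/-- The factor `det(1 - u^l ρ(c))⁻¹` of a cyclic word `c` of length `l`, where `ρ(c)` is the product
of the potentials along `c` (its conjugacy class does not depend on where one starts). -/
noncomputable def eulerFactor (U : E → A) (ρ : Representation ℂ A v) (u : ℂ) (c : Cycle E) : ℂ :=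
  Quotient.liftOn c
    (fun l : List E => (LinearMap.det (1 - u ^ l.length • ρ (l.map U).prod))⁻¹) (by
      rintro l l' ⟨n, rfl⟩
      obtain ⟨k, hk, hn⟩ : ∃ k, k ≤ l.length ∧ l.rotate n = l.rotate k := by
        rcases l.eq_nil_or_concat with rfl | ⟨_, _, rfl⟩
        · exact ⟨0, by simp, by simp⟩
        · exact ⟨_, (Nat.mod_lt n (by simp)).le, (List.rotate_mod _ _).symm⟩
      have h1 : l = l.take k ++ l.drop k := (List.take_append_drop k l).symm
      rw [hn, List.length_rotate, List.rotate_eq_drop_append_take hk, List.map_append,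
        List.prod_append]
      conv_lhs => rw [show (l.map U).prod = ((l.take k).map U).prod * ((l.drop k).map U).prod by
        rw [← List.prod_append, ← List.map_append, ← h1]]
      generalize ((l.take k).map U).prod = a
      generalize ((l.drop k).map U).prod = b
      have h2 : (1 : v →ₗ[ℂ] v) - u ^ l.length • ρ (b * a)
          = ρ a⁻¹ * ((1 - u ^ l.length • ρ (a * b)) * ρ a) := by
        rw [sub_mul, mul_sub, one_mul, ← map_mul, inv_mul_cancel, map_one, smul_mul_assoc,
          mul_smul_comm, ← map_mul, ← map_mul]
        congr 3
        group
      have h3 : LinearMap.det (ρ a⁻¹) * LinearMap.det (ρ a) = 1 := by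
        rw [← map_mul, ← map_mul, inv_mul_cancel, map_one, map_one]
      rw [h2, LinearMap.det.map_mul, LinearMap.det.map_mul, mul_left_comm, h3, mul_one])

variable (T) in
/-- The rational function `L` is the Ihara-Selberg `L`-function of `T`: for all small `u` the product
over the proper closed paths without subperiods converges (unconditionally) to `L(u)`. -/
def IsLFunction (U : E → A) (ρ : Representation ℂ A v) (L : RatFunc ℂ) : Prop :=
  ∀ᶠ u in 𝓝 (0 : ℂ),
    HasProd (fun c : T.PrimitivePath => eulerFactor U ρ u c.1) (L.eval (RingHom.id ℂ) u)

end OrientedGraph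

/-! Both halves of the theorem reduce to linear algebra on the finite graph `F`.

Scattering. Outside `F` the graph is a forest of branches: a path that leaves `F` never returns
(`eq_nil_of_isPath`), and every vertex is the end of exactly one path outside `F` that starts in `F`
(`exists_branch_path`, `branch_path_unique`). On a branch each vertex has one edge back and `p`
edges forward, so the prescribed form of `ψ` solves the equation there because `α±` are roots of the
quadratic. On `F` the branches contribute `B(α₊a - α₋b)` with `B = p - Q`
(`isScatteringSolution_iff`). With `a = f + b` on the boundary and `pα₊α₋ = 1`, multiplication by
`α₊` turns the equation into `Δ̃(α₊) f = κ B b`, where `κ = α₊(α₊ - α₋)`. Hence `S b` is `b` plus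
the boundary values of `Δ̃(α₊)⁻¹ κ B b`. Since `B` lives on the boundary, `det(1 + XY) = det(1 +
YX)` moves `det S` to the vertices of `F`, and `Δ̃(α₊) + κB = (α₊/α₋) Δ̃(α₋)` gives the formula.

L-function. Closed paths stay in `F`. The logarithm of the Euler product is a sum over closed words,
which is the sum of `tr (uW)ⁿ / n` for the edge operator `W`; so the product equals `det(1 - uW)⁻¹`
(`eventually_hasProd_eulerFactor`). Bass's identity (`eventually_det_id_sub_edgeOperator`) converts
this to `(1 - u²)^(r₀ - r₁) / det Δ̃(u)`, and the quotient of two values is substituted into `det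
S`. -/

/-! ### Traces of powers and the logarithm of a determinant. -/

section LogDet

variable {ι : Type*} [Fintype ι] [DecidableEq ι]

theorem Matrix.det_sub_scalar_eq_prod_roots (M : Matrix ι ι ℂ) (z : ℂ) :
    (M - algebraMap ℂ (Matrix ι ι ℂ) z).det = (M.charpoly.roots.map fun μ => μ - z).prod := by
  have h1 : (algebraMap ℂ (Matrix ι ι ℂ) z - M).det
      = (M.charpoly.roots.map fun μ => z - μ).prod := by
    have := M.eval_charpoly z
    rw [(IsAlgClosed.splits M.charpoly).eq_prod_roots_of_monic M.charpoly_monic,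
      Polynomial.eval_multiset_prod] at this
    simpa [Matrix.algebraMap_eq_diagonal, Pi.algebraMap_def, Function.comp_def] using this.symm
  have hc : Multiset.card M.charpoly.roots = Fintype.card ι := by
    rw [← M.charpoly_natDegree_eq_dim]
    exact ((IsAlgClosed.splits M.charpoly).natDegree_eq_card_roots).symm
  rw [← neg_sub, Matrix.det_neg, h1, ← hc]
  generalize M.charpoly.roots = t
  induction t using Multiset.induction_on with
  | empty => simp
  | cons a t ih =>
    simp only [Multiset.card_cons, Multiset.map_cons, Multiset.prod_cons, ← ih]
    ring

/-- Factoring `q` into linear factors reduces this to the characteristic polynomial itself, so no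
triangular form of `M` is needed. -/
theorem Matrix.det_aeval_eq_prod_roots (M : Matrix ι ι ℂ) (q : Polynomial ℂ) :
    (Polynomial.aeval M q).det = (M.charpoly.roots.map fun μ => q.eval μ).prod := by
  have hq := IsAlgClosed.splits q
  have hc : Multiset.card M.charpoly.roots = Fintype.card ι := by
    rw [← M.charpoly_natDegree_eq_dim]
    exact ((IsAlgClosed.splits M.charpoly).natDegree_eq_card_roots).symm
  rw [hq.eq_prod_roots]
  generalize q.leadingCoeff = c
  generalize q.roots = s
  induction s using Multiset.induction_on with
  | empty => simp [Matrix.algebraMap_eq_diagonal, hc]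
  | cons a s ih =>
    have h := M.det_sub_scalar_eq_prod_roots a
    simp only [Multiset.map_cons, Multiset.prod_cons]
    rw [mul_left_comm, map_mul, Matrix.det_mul, ih]
    simp only [map_sub, Polynomial.aeval_X, Polynomial.aeval_C, h, Polynomial.eval_mul,
      Polynomial.eval_sub, Polynomial.eval_X, Polynomial.eval_C]
    rw [← Multiset.prod_map_mul]

/-- Taking `q = z - X ^ k` in the previous lemma identifies the characteristic polynomial of `M ^
k`. -/
theorem Matrix.trace_pow_eq_sum_roots (M : Matrix ι ι ℂ) (k : ℕ) :
    (M ^ k).trace = (M.charpoly.roots.map fun μ => μ ^ k).sum := by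
  have h : (M ^ k).charpoly
      = ((M.charpoly.roots.map fun μ => μ ^ k).map fun a => Polynomial.X - Polynomial.C a).prod := by
    refine Polynomial.funext fun z => ?_
    have := M.det_aeval_eq_prod_roots (Polynomial.C z - Polynomial.X ^ k)
    rw [Matrix.eval_charpoly, Polynomial.eval_multiset_prod]
    simpa [Matrix.algebraMap_eq_diagonal, Pi.algebraMap_def, Function.comp_def] using this
  rw [Matrix.trace_eq_sum_roots_charpoly, h, Polynomial.roots_multiset_prod_X_sub_C]

/-- The sum is `-log (1 - μ)` added over the eigenvalues. Only its exponential is recorded, since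
principal logarithms need not add up to that of the determinant. -/
theorem Matrix.exists_hasSum_trace_pow (M : Matrix ι ι ℂ)
    (hM : ∀ μ ∈ M.charpoly.roots, ‖μ‖ < 1) :
    ∃ s : ℂ, HasSum (fun k : ℕ => (M ^ (k + 1)).trace / ((k + 1 : ℕ) : ℂ)) s ∧
      Complex.exp s = ((1 - M).det)⁻¹ := by
  have hdet : (1 - M).det = (M.charpoly.roots.map fun μ => 1 - μ).prod := by
    have := M.det_aeval_eq_prod_roots (1 - Polynomial.X)
    simpa using this
  simp only [hdet, Matrix.trace_pow_eq_sum_roots]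
  generalize M.charpoly.roots = t at hM
  induction t using Multiset.induction_on with
  | empty => exact ⟨0, by simp, by simp⟩
  | cons a t ih =>
    obtain ⟨s, hs, he⟩ := ih fun μ hμ => hM μ (Multiset.mem_cons_of_mem hμ)
    have ha : ‖a‖ < 1 := hM a (Multiset.mem_cons_self a t)
    have h1 : HasSum (fun k : ℕ => a ^ (k + 1) / ((k + 1 : ℕ) : ℂ)) (-Complex.log (1 - a)) := by
      have := Complex.hasSum_taylorSeries_neg_log ha
      rw [← hasSum_nat_add_iff' 1] at this
      simpa using this
    refine ⟨-Complex.log (1 - a) + s, ?_, ?_⟩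
    · simpa [add_div] using h1.add hs
    · have h0 : (1 : ℂ) - a ≠ 0 := by
        intro h
        rw [sub_eq_zero] at h
        simp [← h] at ha
      rw [Complex.exp_add, he, Complex.exp_neg, Complex.exp_log h0]
      simp [mul_comm]

end LogDet

/-! ### Periods and primitive roots of cyclic words. -/

section Words

namespace List

variable {E : Type*}

/-- The least positive number of rotation steps that leaves the word `l` unchanged. -/
noncomputable def rotationPeriod (l : List E) : ℕ :=
  Function.minimalPeriod (fun l : List E => l.rotate 1) l

theorem iterate_rotate_one (k : ℕ) (l : List E) :
    (fun l : List E => l.rotate 1)^[k] l = l.rotate k := by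
  induction k generalizing l with
  | zero => simp
  | succ k ih => rw [Function.iterate_succ_apply, ih, rotate_rotate, add_comm]

theorem isPeriodicPt_rotate_iff {k : ℕ} {l : List E} :
    Function.IsPeriodicPt (fun l : List E => l.rotate 1) k l ↔ l.rotate k = l := by
  rw [Function.IsPeriodicPt, Function.IsFixedPt, iterate_rotate_one]

theorem rotate_eq_self_iff_rotationPeriod_dvd {k : ℕ} {l : List E} :
    l.rotate k = l ↔ l.rotationPeriod ∣ k := by
  rw [← isPeriodicPt_rotate_iff, Function.isPeriodicPt_iff_minimalPeriod_dvd, rotationPeriod]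

theorem rotationPeriod_dvd_length (l : List E) : l.rotationPeriod ∣ l.length :=
  rotate_eq_self_iff_rotationPeriod_dvd.1 l.rotate_length

theorem rotate_injOn_rotationPeriod (l : List E) :
    (Set.Iio l.rotationPeriod).InjOn fun k => l.rotate k := by
  have := Function.iterate_injOn_Iio_minimalPeriod (f := fun l : List E => l.rotate 1) (x := l)
  simp only [iterate_rotate_one] at this
  exact this

theorem append_flatten_replicate_append (x y : List E) (n : ℕ) :
    x ++ (replicate n (y ++ x)).flatten = (replicate n (x ++ y)).flatten ++ x := by
  induction n with
  | zero => simp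
  | succ n ih => simp [replicate_succ, ih]

theorem rotate_flatten_replicate (z : List E) (n : ℕ) {j : ℕ} (hj : j ≤ z.length) :
    (replicate n z).flatten.rotate j = (replicate n (z.rotate j)).flatten := by
  rcases n with _ | n
  · simp
  obtain ⟨x, y, rfl, rfl⟩ : ∃ x y, z = x ++ y ∧ j = x.length :=
    ⟨z.take j, z.drop j, (take_append_drop j z).symm, by simp [hj]⟩
  rw [rotate_append_length_eq, replicate_succ, replicate_succ, flatten_cons, flatten_cons,
    append_assoc, rotate_append_length_eq, append_assoc, append_assoc, append_flatten_replicate_append]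

theorem flatten_replicate_inj {z z' : List E} {n : ℕ} (hlen : z.length = z'.length)
    (h : (replicate (n + 1) z).flatten = (replicate (n + 1) z').flatten) : z = z' := by
  rw [replicate_succ, replicate_succ, flatten_cons, flatten_cons] at h
  exact append_inj_left h hlen

theorem length_flatten_replicate (z : List E) (n : ℕ) :
    (replicate n z).flatten.length = n * z.length := by
  simp

theorem rotationPeriod_flatten_replicate (z : List E) (n : ℕ) :
    (replicate (n + 1) z).flatten.rotationPeriod = z.rotationPeriod := by
  rcases eq_or_ne z [] with rfl | hz
  · simp
  apply Nat.dvd_antisymm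
  · rw [← rotate_eq_self_iff_rotationPeriod_dvd, rotate_flatten_replicate _ _
      (Nat.le_of_dvd (length_pos_of_ne_nil hz) z.rotationPeriod_dvd_length),
      rotate_eq_self_iff_rotationPeriod_dvd.2 dvd_rfl]
  · have h1 : (replicate (n + 1) z).flatten.rotationPeriod ∣ z.length := by
      rw [← rotate_eq_self_iff_rotationPeriod_dvd, rotate_flatten_replicate _ _ le_rfl,
        rotate_length]
    have h2 : (replicate (n + 1) z).flatten.rotate (replicate (n + 1) z).flatten.rotationPeriod
        = (replicate (n + 1) z).flatten := rotate_eq_self_iff_rotationPeriod_dvd.2 dvd_rfl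
    rw [rotate_flatten_replicate _ _ (Nat.le_of_dvd (length_pos_of_ne_nil hz) h1)] at h2
    exact rotate_eq_self_iff_rotationPeriod_dvd.1 (flatten_replicate_inj (by simp) h2)

/-- Commutation makes `x` a prefix of `y`, and what remains of `y` still commutes with `x`. -/
theorem eq_flatten_replicate_of_append_comm (x : List E) (m : ℕ) (y : List E)
    (h : x ++ y = y ++ x) (hlen : y.length = m * x.length) : y = (replicate m x).flatten := by
  induction m generalizing y with
  | zero => simpa using hlen
  | succ m ih =>
    have hxy : x <+: y := by
      refine prefix_of_prefix_length_le ⟨y, h⟩ ⟨x, rfl⟩ ?_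
      rw [hlen]
      exact Nat.le_mul_of_pos_left _ m.succ_pos
    obtain ⟨y', rfl⟩ := hxy
    rw [replicate_succ, flatten_cons, ← ih y']
    · simpa using h
    · rw [length_append, Nat.succ_mul] at hlen
      omega

theorem eq_flatten_replicate_take {w : List E} {d m : ℕ} (hm : w.length = m * d)
    (h : w.rotate d = w) (hd : d ≤ w.length) : w = (replicate m (w.take d)).flatten := by
  refine eq_flatten_replicate_of_append_comm _ _ _ ?_ (by simp [hm, hm ▸ hd])
  have h1 : w.drop d ++ w.take d = w := by rw [← rotate_eq_drop_append_take hd, h]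
  calc w.take d ++ w = w.take d ++ (w.drop d ++ w.take d) := by rw [h1]
    _ = w ++ w.take d := by rw [← append_assoc, take_append_drop]

/-- Every nonempty word is a power of a word which equals none of its proper rotations. -/
theorem exists_eq_flatten_replicate {w : List E} (hw : w ≠ []) :
    ∃ (z : List E) (k : ℕ), w = (replicate (k + 1) z).flatten ∧ z.rotationPeriod = z.length := by
  obtain ⟨m, hm⟩ := w.rotationPeriod_dvd_length
  have hpos := length_pos_of_ne_nil hw
  obtain ⟨k, rfl⟩ : ∃ k, m = k + 1 := Nat.exists_eq_succ_of_ne_zero (by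
    rintro rfl
    omega)
  have hd := Nat.le_of_dvd hpos w.rotationPeriod_dvd_length
  have h := eq_flatten_replicate_take (hm.trans (mul_comm _ _))
    (rotate_eq_self_iff_rotationPeriod_dvd.2 dvd_rfl) hd
  refine ⟨w.take w.rotationPeriod, k, h, ?_⟩
  rw [← rotationPeriod_flatten_replicate _ k, ← h, length_take, min_eq_left hd]

/-- A power has the same rotation period as its base, so it determines the length of a primitive
root, and then the exponent. -/
theorem flatten_replicate_injective {z z' : List E} {k k' : ℕ} (hz : z ≠ [])
    (hp : z.rotationPeriod = z.length) (hp' : z'.rotationPeriod = z'.length)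
    (h : (replicate (k + 1) z).flatten = (replicate (k' + 1) z').flatten) : z = z' ∧ k = k' := by
  have hlen : z.length = z'.length := by
    rw [← hp, ← hp', ← rotationPeriod_flatten_replicate z k, h, rotationPeriod_flatten_replicate]
  have hk : k = k' := by
    have := congrArg length h
    rw [length_flatten_replicate, length_flatten_replicate, hlen] at this
    have hpos : 0 < z'.length := hlen ▸ length_pos_of_ne_nil hz
    have := Nat.eq_of_mul_eq_mul_right hpos this
    omega
  subst hk
  exact ⟨flatten_replicate_inj hlen h, rfl⟩

theorem prod_map_flatten_replicate {M : Type*} [Monoid M] (G : E → M) (z : List E) (n : ℕ) :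
    ((replicate n z).flatten.map G).prod = (z.map G).prod ^ n := by
  induction n with
  | zero => simp
  | succ n ih => rw [replicate_succ, flatten_cons, map_append, prod_append, ih, pow_succ']

theorem cycleChain_flatten_replicate (r : E → E → Prop) (z : List E) (n : ℕ) :
    Cycle.Chain r ((replicate (n + 1) z).flatten : Cycle E) ↔ Cycle.Chain r (z : Cycle E) := by
  rcases z with _ | ⟨a, t⟩
  · simp
  have h : ∀ n, (replicate (n + 1) (a :: t)).flatten ++ [a]
      = (a :: t) ++ (replicate n (a :: t)).flatten ++ [a] := by
    intro n
    rw [replicate_succ, flatten_cons]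
  have key : IsChain r ((replicate (n + 1) (a :: t)).flatten ++ [a])
      ↔ IsChain r ((a :: t) ++ [a]) := by
    induction n with
    | zero => simp
    | succ n ih =>
      have h2 : (replicate (n + 1 + 1) (a :: t)).flatten ++ [a]
          = (a :: t) ++ a :: (t ++ (replicate n (a :: t)).flatten ++ [a]) := by
        simp [replicate_succ]
      have h3 : (replicate (n + 1) (a :: t)).flatten ++ [a]
          = a :: (t ++ (replicate n (a :: t)).flatten ++ [a]) := by
        simp [replicate_succ]
      rw [h2, isChain_split, ← h3, ih, and_self]
  have h4 : (replicate (n + 1) (a :: t)).flatten = a :: (t ++ (replicate n (a :: t)).flatten) := by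
    simp [replicate_succ]
  rw [h4] at key
  rw [h4, Cycle.chain_coe_cons, Cycle.chain_coe_cons]
  simpa using key

end List

namespace OrientedGraph

variable {E : Type*}

/-- `HasNoPeriods` concerns every representative, but any rotation of an `n`-fold power of `y` is
still fixed by `y.length` steps, so one word decides. -/
theorem hasNoPeriods_coe_iff {z : List E} (hz : z ≠ []) :
    HasNoPeriods (z : Cycle E) ↔ z.rotationPeriod = z.length := by
  constructor
  · intro h
    by_contra hne
    obtain ⟨y, k, hk, hy⟩ := List.exists_eq_flatten_replicate hz
    refine h ⟨y, k + 1, ?_, by rw [← hk]⟩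
    rcases k with _ | k
    · simp only [zero_add, List.replicate_one, List.flatten_singleton] at hk
      exact absurd (hk ▸ hy) hne
    · omega
  · rintro h ⟨y, n, hn, hy⟩
    obtain ⟨k, rfl⟩ : ∃ k, n = k + 1 := Nat.exists_eq_succ_of_ne_zero (by omega)
    obtain ⟨j, hj⟩ := Cycle.coe_eq_coe.1 hy.symm
    have h1 : z.rotate y.length = z := by
      rw [← hj, List.rotate_rotate, Nat.add_comm j, ← List.rotate_rotate,
        List.rotate_flatten_replicate _ _ le_rfl, List.rotate_length]
    have h2 := List.rotate_eq_self_iff_rotationPeriod_dvd.1 h1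
    have h3 : z.length = (k + 1) * y.length := by
      rw [← hj, List.length_rotate, List.length_flatten_replicate]
    have h4 := List.length_pos_of_ne_nil hz
    have h5 : 0 < y.length := by
      rcases Nat.eq_zero_or_pos y.length with h0 | h0
      · rw [h0, mul_zero] at h3
        omega
      · exact h0
    have h6 := Nat.le_of_dvd h5 h2
    have : 2 * y.length ≤ (k + 1) * y.length := Nat.mul_le_mul_right _ hn
    omega

/-- The words that represent an aperiodic cyclic word are its pairwise distinct rotations. -/
theorem bijective_rotate_of_rotationPeriod {z : List E} (hz : z.rotationPeriod = z.length)
    (hne : z ≠ []) :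
    Function.Bijective (fun k : Fin z.length =>
      (⟨z.rotate k, Cycle.coe_eq_coe.2 (List.IsRotated.forall z k)⟩ :
        {y : List E // (y : Cycle E) = z})) := by
  constructor
  · intro i j hij
    refine Fin.ext (z.rotate_injOn_rotationPeriod ?_ ?_ (Subtype.ext_iff.1 hij))
    · simp [hz]
    · simp [hz]
  · rintro ⟨y, hy⟩
    obtain ⟨k, hk⟩ := Cycle.coe_eq_coe.1 hy.symm
    refine ⟨⟨k % z.length, Nat.mod_lt _ (List.length_pos_of_ne_nil hne)⟩, Subtype.ext ?_⟩
    simp [List.rotate_mod, hk]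

end OrientedGraph

end Words

/-! ### Transfer matrices and sums over closed words. -/

section CyclicWords

variable {α : Type*} [Fintype α] [DecidableEq α]

open Classical in
/-- The block matrix with the entry `G j` at `(i, j)` whenever `j` may follow `i`. -/
noncomputable def transferMatrix {R : Type*} [Zero R] (r : α → α → Prop) (G : α → R) :
    Matrix α α R := Matrix.of fun i j => if r i j then G j else 0

-- The weight sits on the column index, so a walk from `i` collects the weights of all its letters
-- except the initial `i`.
open Classical in
theorem transferMatrix_pow_apply {R : Type*} [Semiring R] (r : α → α → Prop) (G : α → R) (n : ℕ)
    (i j : α) :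
    (transferMatrix r G ^ n) i j = ∑ w : Fin n → α,
      if List.IsChain r (i :: List.ofFn w) ∧ (i :: List.ofFn w).getLast (by simp) = j
      then ((List.ofFn w).map G).prod else 0 := by
  induction n generalizing i with
  | zero => simp [Matrix.one_apply]
  | succ n ih =>
    rw [pow_succ', Matrix.mul_apply, ← (Fin.consEquiv fun _ => α).sum_comp, Fintype.sum_prod_type]
    refine Finset.sum_congr rfl fun k _ => ?_
    rw [ih, Finset.mul_sum]
    refine Finset.sum_congr rfl fun w _ => ?_
    simp only [Fin.consEquiv_apply, List.ofFn_succ, Fin.cons_zero, Fin.cons_succ,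
      List.isChain_cons_cons, List.map_cons, List.prod_cons, transferMatrix, Matrix.of_apply]
    rw [List.getLast_cons (List.cons_ne_nil _ _)]
    by_cases h : r i k
    · simp only [h, if_true, true_and, mul_ite, mul_zero]
    · simp only [h, if_false, false_and, zero_mul]

-- On the diagonal the initial letter is the last letter of the walk, which is exactly the closing
-- condition of a cyclic chain.
open Classical in
theorem trace_transferMatrix_pow {R : Type*} [Semiring R] (r : α → α → Prop) (G : α → R) (n : ℕ) :
    (transferMatrix r G ^ (n + 1)).trace = ∑ w : Fin (n + 1) → α,
      if Cycle.Chain r (List.ofFn w : Cycle α) then ((List.ofFn w).map G).prod else 0 := by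
  simp only [Matrix.trace, Matrix.diag_apply, transferMatrix_pow_apply]
  rw [Finset.sum_comm]
  refine Finset.sum_congr rfl fun w _ => ?_
  have hne : List.ofFn w ≠ [] := by simp
  rw [Cycle.chain_ne_nil r hne, Finset.sum_eq_single ((List.ofFn w).getLast hne)]
  · simp
  · intro b _ hb
    rw [if_neg]
    rintro ⟨-, h⟩
    rw [List.getLast_cons hne] at h
    exact hb h.symm
  · simp

variable {ι : Type*} [Fintype ι] [DecidableEq ι]

open Classical in
/-- The term of the logarithm of the Euler product that belongs to a word. -/
noncomputable def cyclicWordTerm {E : Type*} (r : E → E → Prop) (G : E → Matrix ι ι ℂ) (u : ℂ)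
    (w : List E) : ℂ :=
  if w ≠ [] ∧ Cycle.Chain r (w : Cycle E)
  then u ^ w.length * (w.map G).prod.trace / (w.length : ℂ) else 0

theorem trace_comp_transferMatrix_pow (r : α → α → Prop) (G : α → Matrix ι ι ℂ) (u : ℂ) (n : ℕ) :
    ((u • Matrix.comp α α ι ι ℂ (transferMatrix r G)) ^ (n + 1)).trace / ((n + 1 : ℕ) : ℂ)
      = ∑ w : Fin (n + 1) → α, cyclicWordTerm r G u (List.ofFn w) := by
  classical
  have h1 : ∀ M : Matrix α α (Matrix ι ι ℂ), (Matrix.comp α α ι ι ℂ M).trace = M.trace.trace := by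
    intro M
    simp only [Matrix.trace, Matrix.diag_apply, Fintype.sum_prod_type, Matrix.comp_apply,
      Matrix.sum_apply]
    rw [Finset.sum_comm]
  have h2 : Matrix.comp α α ι ι ℂ (transferMatrix r G) ^ (n + 1)
      = Matrix.comp α α ι ι ℂ (transferMatrix r G ^ (n + 1)) :=
    (map_pow (Matrix.compRingEquiv α ι ℂ) (transferMatrix r G) (n + 1)).symm
  rw [smul_pow, Matrix.trace_smul, h2, h1, trace_transferMatrix_pow, Matrix.trace_sum,
    Finset.smul_sum, Finset.sum_div]
  refine Finset.sum_congr rfl fun w _ => ?_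
  rw [cyclicWordTerm]
  have hne : List.ofFn w ≠ [] := by simp
  by_cases h : Cycle.Chain r (List.ofFn w : Cycle α)
  · rw [if_pos h, if_pos ⟨hne, h⟩]
    simp
  · rw [if_neg h, if_neg fun h' => h h'.2]
    simp

section Norm

attribute [local instance] Matrix.linftyOpNormedRing Matrix.linftyOpNormedAlgebra

theorem Matrix.norm_le_of_mem_roots_charpoly {M : Matrix ι ι ℂ} {μ : ℂ}
    (hμ : μ ∈ M.charpoly.roots) : ‖μ‖ ≤ ‖M‖ := by
  cases isEmpty_or_nonempty ι
  · simp at hμ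
  · exact spectrum.norm_le_norm_of_mem
      (Matrix.mem_spectrum_of_isRoot_charpoly (Polynomial.isRoot_of_mem_roots hμ))

theorem Matrix.norm_trace_le_linfty (M : Matrix ι ι ℂ) : ‖M.trace‖ ≤ Fintype.card ι * ‖M‖ := by
  have h : ∀ i ∈ Finset.univ, ‖M.diag i‖ ≤ ‖M‖ := by
    intro i _
    rw [Matrix.linfty_opNorm_def]
    refine le_trans ?_ (NNReal.coe_le_coe.2 (Finset.le_sup (Finset.mem_univ i)))
    rw [NNReal.coe_sum]
    exact Finset.single_le_sum (f := fun j => ((‖M i j‖₊ : NNReal) : ℝ))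
      (fun j _ => NNReal.coe_nonneg _) (Finset.mem_univ i)
  refine (norm_sum_le _ _).trans ((Finset.sum_le_sum h).trans ?_)
  simp

theorem List.norm_prod_map_matrix_le {E : Type*} {G : E → Matrix ι ι ℂ} {C : ℝ} {w : List E}
    (hC : ∀ e ∈ w, ‖G e‖ ≤ C) :
    ‖(w.map G).prod‖ ≤ ‖(1 : Matrix ι ι ℂ)‖ * C ^ w.length := by
  induction w with
  | nil => simp
  | cons a w ih =>
    have h1 := ih fun e he => hC e (List.mem_cons_of_mem a he)
    have h2 := hC a List.mem_cons_self
    simp only [List.map_cons, List.prod_cons, List.length_cons, pow_succ]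
    calc ‖G a * (w.map G).prod‖ ≤ ‖G a‖ * ‖(w.map G).prod‖ := norm_mul_le _ _
      _ ≤ C * (‖(1 : Matrix ι ι ℂ)‖ * C ^ w.length) :=
        mul_le_mul h2 h1 (norm_nonneg _) ((norm_nonneg _).trans h2)
      _ = _ := by ring

omit [DecidableEq α] in
theorem exists_forall_norm_le (G : α → Matrix ι ι ℂ) : ∃ C : ℝ, 0 ≤ C ∧ ∀ a, ‖G a‖ ≤ C :=
  ⟨∑ a, ‖G a‖, Finset.sum_nonneg fun _ _ => norm_nonneg _, fun a =>
    Finset.single_le_sum (f := fun a => ‖G a‖) (fun _ _ => norm_nonneg _) (Finset.mem_univ a)⟩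

-- The norms are at most `(‖u‖ C) ^ length`, so one disc serves all words; the Euler product has
-- infinitely many factors at the same `u`.
omit [DecidableEq α] in
theorem eventually_norm_lt_one_of_mem_roots (G : α → Matrix ι ι ℂ) :
    ∀ᶠ u in 𝓝 (0 : ℂ), ∀ w : List α, w ≠ [] →
      ∀ μ ∈ (u ^ w.length • (w.map G).prod).charpoly.roots, ‖μ‖ < 1 := by
  obtain ⟨C, hC0, hC⟩ := exists_forall_norm_le G
  have hev : ∀ᶠ u in 𝓝 (0 : ℂ), ‖u‖ * C < 1 := by
    have : Continuous fun u : ℂ => ‖u‖ * C := by fun_prop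
    exact this.continuousAt.eventually_lt continuousAt_const (by simp)
  filter_upwards [hev] with u hu w hw μ hμ
  cases isEmpty_or_nonempty ι
  · simp at hμ
  calc ‖μ‖ ≤ ‖u ^ w.length • (w.map G).prod‖ := Matrix.norm_le_of_mem_roots_charpoly hμ
    _ ≤ ‖u‖ ^ w.length * (‖(1 : Matrix ι ι ℂ)‖ * C ^ w.length) := by
      rw [norm_smul, norm_pow]
      exact mul_le_mul_of_nonneg_left (List.norm_prod_map_matrix_le fun e _ => hC e)
        (by positivity)
    _ = (‖u‖ * C) ^ w.length := by rw [norm_one, one_mul, mul_pow]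
    _ < 1 := pow_lt_one₀ (by positivity) hu (List.length_pos_of_ne_nil hw).ne'

-- There are `card α ^ n` words of length `n`, each with a term of order `(‖u‖ C) ^ n`. Absolute
-- summability is what permits regrouping by primitive paths later.
omit [DecidableEq α] in
theorem summable_cyclicWordTerm (r : α → α → Prop) (G : α → Matrix ι ι ℂ) :
    ∀ᶠ u in 𝓝 (0 : ℂ), Summable (cyclicWordTerm r G u) := by
  obtain ⟨C, hC0, hC⟩ := exists_forall_norm_le G
  set K : ℝ := Fintype.card ι * ‖(1 : Matrix ι ι ℂ)‖ with hK
  have hK0 : 0 ≤ K := by positivity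
  have hterm : ∀ u w, ‖cyclicWordTerm r G u w‖ ≤ K * (‖u‖ * C) ^ w.length := by
    intro u w
    rw [cyclicWordTerm]
    split_ifs with h
    · have hl : (1 : ℝ) ≤ w.length := by
        exact_mod_cast List.length_pos_of_ne_nil h.1
      rw [norm_div, norm_mul, norm_pow, Complex.norm_natCast, mul_pow]
      refine (div_le_self (by positivity) hl).trans ?_
      have h1 := (Matrix.norm_trace_le_linfty (w.map G).prod).trans
        (mul_le_mul_of_nonneg_left (List.norm_prod_map_matrix_le fun e _ => hC e)
          (Nat.cast_nonneg _))
      calc _ ≤ ‖u‖ ^ w.length * (Fintype.card ι * (‖(1 : Matrix ι ι ℂ)‖ * C ^ w.length)) :=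
            mul_le_mul_of_nonneg_left h1 (by positivity)
        _ = _ := by rw [hK]; ring
    · rw [norm_zero]
      positivity
  have hev : ∀ᶠ u in 𝓝 (0 : ℂ), ‖u‖ * C * Fintype.card α < 1 := by
    have : Continuous fun u : ℂ => ‖u‖ * C * Fintype.card α := by fun_prop
    exact this.continuousAt.eventually_lt continuousAt_const (by simp)
  filter_upwards [hev] with u hu
  rw [← List.equivSigmaTuple.symm.summable_iff]
  refine Summable.of_norm ?_
  refine Summable.of_nonneg_of_le (f := fun x : Σ n, Fin n → α => K * (‖u‖ * C) ^ x.1)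
    (fun _ => norm_nonneg _) (fun x => (hterm u _).trans (by simp [List.equivSigmaTuple])) ?_
  rw [summable_sigma_of_nonneg fun _ => by positivity]
  refine ⟨fun n => (hasSum_fintype _).summable, ?_⟩
  simp only [tsum_fintype, Finset.sum_const, Finset.card_univ, Fintype.card_pi_const, nsmul_eq_mul]
  refine ((summable_geometric_of_lt_one (by positivity) hu).mul_left K).congr fun n => ?_
  rw [mul_pow _ (Fintype.card α : ℝ)]
  push_cast
  ring

theorem exists_hasSum_cyclicWordTerm (r : α → α → Prop) (G : α → Matrix ι ι ℂ) :
    ∀ᶠ u in 𝓝 (0 : ℂ), ∃ s, HasSum (cyclicWordTerm r G u) s ∧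
      Complex.exp s = ((1 - u • Matrix.comp α α ι ι ℂ (transferMatrix r G)).det)⁻¹ := by
  set N := Matrix.comp α α ι ι ℂ (transferMatrix r G)
  have hev : ∀ᶠ u in 𝓝 (0 : ℂ), ‖u • N‖ < 1 := by
    have : Continuous fun u : ℂ => ‖u • N‖ := by fun_prop
    exact this.continuousAt.eventually_lt continuousAt_const (by simp)
  filter_upwards [hev, summable_cyclicWordTerm r G] with u hu hs
  obtain ⟨s, hs1, hs2⟩ := (u • N).exists_hasSum_trace_pow fun μ hμ =>
    (Matrix.norm_le_of_mem_roots_charpoly hμ).trans_lt hu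
  refine ⟨s, ?_, hs2⟩
  have h1 := hs.hasSum
  rw [← List.equivSigmaTuple.symm.hasSum_iff] at h1
  have h2 := h1.sigma fun n => hasSum_fintype _
  -- The group of length 0 is the empty word, whose term is zero; the trace series starts at the
  -- first power.
  rw [← hasSum_nat_add_iff' 1] at h2
  simp only [Function.comp_apply, List.equivSigmaTuple, Equiv.coe_fn_symm_mk] at h2
  simp only [N, trace_comp_transferMatrix_pow] at hs1
  have h3 := hs1.unique h2
  rw [h3]
  simpa [cyclicWordTerm] using hs.hasSum

end Norm

end CyclicWords

/-! ### The Euler product as a determinant. -/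

section EulerProduct

variable {E ι : Type*} [Fintype ι] [DecidableEq ι]

theorem Matrix.trace_prod_map_rotate (G : E → Matrix ι ι ℂ) (w : List E) (n : ℕ) :
    ((w.rotate n).map G).prod.trace = (w.map G).prod.trace := by
  induction n generalizing w with
  | zero => simp
  | succ n ih =>
    rcases w with _ | ⟨a, w⟩
    · simp
    · rw [List.rotate_cons_succ, ih, List.map_append, List.prod_append, Matrix.trace_mul_comm]
      simp

theorem cyclicWordTerm_rotate (r : E → E → Prop) (G : E → Matrix ι ι ℂ) (u : ℂ) (w : List E)
    (n : ℕ) : cyclicWordTerm r G u (w.rotate n) = cyclicWordTerm r G u w := by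
  have h : ((w.rotate n : List E) : Cycle E) = w := Cycle.coe_eq_coe.2 (List.IsRotated.forall w n)
  classical
  rw [cyclicWordTerm, cyclicWordTerm]
  apply if_congr _ _ rfl
  · rw [h, ne_eq, List.rotate_eq_nil_iff]
  · rw [List.length_rotate, Matrix.trace_prod_map_rotate]

theorem cyclicWordTerm_map {α : Type*} (f : α → E) (r : E → E → Prop) (G : E → Matrix ι ι ℂ)
    (u : ℂ) (w : List α) : cyclicWordTerm r G u (w.map f)
      = cyclicWordTerm (fun i j => r (f i) (f j)) (fun i => G (f i)) u w := by
  have h : Cycle.Chain r ((w.map f : List E) : Cycle E)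
      ↔ Cycle.Chain (fun i j => r (f i) (f j)) (w : Cycle α) := by
    rw [← Cycle.map_coe, Cycle.chain_map]
  classical
  rw [cyclicWordTerm, cyclicWordTerm]
  apply if_congr _ _ rfl
  · rw [h, ne_eq, List.map_eq_nil_iff]
  · rw [List.length_map, List.map_map]
    rfl

theorem cyclicWordTerm_flatten_replicate {r : E → E → Prop} (G : E → Matrix ι ι ℂ) (u : ℂ)
    {z : List E} (hz : z ≠ []) (hr : Cycle.Chain r (z : Cycle E)) (k : ℕ) :
    cyclicWordTerm r G u (List.replicate (k + 1) z).flatten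
      = ((u ^ z.length • (z.map G).prod) ^ (k + 1)).trace / ((k + 1 : ℕ) : ℂ) / z.length := by
  have hne : (List.replicate (k + 1) z).flatten ≠ [] := by
    simp [List.replicate_succ, hz]
  rw [cyclicWordTerm, if_pos ⟨hne, (List.cycleChain_flatten_replicate r z k).2 hr⟩,
    List.prod_map_flatten_replicate, smul_pow, Matrix.trace_smul, List.length_flatten_replicate,
    div_div, Nat.cast_mul, smul_eq_mul, ← pow_mul, mul_comm z.length]

namespace OrientedGraph

variable {V A v : Type*} [Group A] [AddCommGroup v] [Module ℂ v] (T : OrientedGraph V E)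

theorem eulerFactor_coe_eq_det (b : Module.Basis ι ℂ v) (U : E → A) (ρ : Representation ℂ A v)
    (u : ℂ) (z : List E) : eulerFactor U ρ u (z : Cycle E)
      = ((1 - u ^ z.length • (z.map fun e => LinearMap.toMatrix b b (ρ (U e))).prod).det)⁻¹ := by
  have h : (z.map fun e => LinearMap.toMatrix b b (ρ (U e))).prod
      = LinearMap.toMatrix b b (ρ (z.map U).prod) := by
    induction z with
    | nil => simp [Module.End.one_eq_id]
    | cons a z ih => simp [ih, LinearMap.toMatrix_mul]
  change (LinearMap.det (1 - u ^ z.length • ρ (z.map U).prod))⁻¹ = _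
  rw [h, ← LinearMap.det_toMatrix b, map_sub, map_smul, LinearMap.toMatrix_one]

/-- The words that represent closed paths are the powers of those that represent primitive ones. -/
theorem flatten_replicate_injective_primitivePath :
    Function.Injective (fun x : Σ _ : (Σ c : T.PrimitivePath, {z : List E // (z : Cycle E) = c.1}),
      ℕ => (List.replicate (x.2 + 1) x.1.2.1).flatten) := by
  have hrep : ∀ (c : T.PrimitivePath) (z : List E), (z : Cycle E) = c.1 →
      ∃ h, c = ⟨(z : Cycle E), h⟩ := fun c z h => ⟨h ▸ c.2, Subtype.ext h.symm⟩
  rintro ⟨⟨c, z, hcz⟩, k⟩ ⟨⟨c', z', hcz'⟩, k'⟩ h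
  obtain ⟨⟨⟨hc0, hc⟩, hp⟩, rfl⟩ := hrep c z hcz
  obtain ⟨⟨⟨hc0', hc'⟩, hp'⟩, rfl⟩ := hrep c' z' hcz'
  have hz : z ≠ [] := fun h => hc0 (by simp [h])
  have hz' : z' ≠ [] := fun h => hc0' (by simp [h])
  obtain ⟨rfl, rfl⟩ := List.flatten_replicate_injective hz ((hasNoPeriods_coe_iff hz).1 hp)
    ((hasNoPeriods_coe_iff hz').1 hp') h
  rfl

theorem mem_range_flatten_replicate {w : List E} (hw : w ≠ [])
    (hr : Cycle.Chain T.Follows (w : Cycle E)) :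
    w ∈ Set.range (fun x :
      Σ _ : (Σ c : T.PrimitivePath, {z : List E // (z : Cycle E) = c.1}), ℕ =>
        (List.replicate (x.2 + 1) x.1.2.1).flatten) := by
  obtain ⟨z, k, rfl, hz⟩ := List.exists_eq_flatten_replicate hw
  have hne : z ≠ [] := by
    rintro rfl
    simp at hw
  exact ⟨⟨⟨⟨(z : Cycle E), ⟨by simpa using hne, (List.cycleChain_flatten_replicate _ z k).1 hr⟩,
    (hasNoPeriods_coe_iff hne).2 hz⟩, z, rfl⟩, k⟩, rfl⟩

/-- The Euler product as the determinant of the transfer matrix of a finite set of edges that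
carries all closed paths. -/
theorem eventually_hasProd_eulerFactor (b : Module.Basis ι ℂ v) (U : E → A)
    (ρ : Representation ℂ A v) (s : Finset E) [DecidableEq s]
    (hs : ∀ c : Cycle E, T.IsProperClosedPath c → ∀ e ∈ c, e ∈ s) :
    ∀ᶠ u in 𝓝 (0 : ℂ), HasProd (fun c : T.PrimitivePath => eulerFactor U ρ u c.1)
      ((1 - u • Matrix.comp s s ι ι ℂ (transferMatrix (fun i j : s => T.Follows i j)
        (fun e : s => LinearMap.toMatrix b b (ρ (U e))))).det)⁻¹ := by
  set G : E → Matrix ι ι ℂ := fun e => LinearMap.toMatrix b b (ρ (U e)) with hG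
  have hlift : ∀ w : List E, w ≠ [] → Cycle.Chain T.Follows (w : Cycle E) →
      ∃ w' : List s, w'.map Subtype.val = w := by
    intro w hw hc
    lift w to List s using fun e he => hs _ ⟨by simpa using hw, hc⟩ e (by simpa using he)
    exact ⟨w, rfl⟩
  filter_upwards [exists_hasSum_cyclicWordTerm (fun i j : s => T.Follows i j) (fun e : s => G e),
    eventually_norm_lt_one_of_mem_roots (fun e : s => G e)] with u ⟨t, ht, hexp⟩ hroots
  rw [← hexp]
  have ht' : HasSum (cyclicWordTerm T.Follows G u) t := by
    have hinj : Function.Injective (List.map (Subtype.val : s → E)) :=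
      List.map_injective_iff.2 Subtype.val_injective
    rw [← hinj.hasSum_iff]
    · convert ht using 1
      funext w
      exact cyclicWordTerm_map _ _ _ _ _
    · intro w hw
      rw [cyclicWordTerm, if_neg]
      rintro ⟨h1, h2⟩
      exact hw (hlift w h1 h2)
  -- Words are reindexed by primitive path, representative and exponent; all other words have term
  -- zero.
  rw [← T.flatten_replicate_injective_primitivePath.hasSum_iff (by
    intro w hw
    rw [cyclicWordTerm, if_neg]
    rintro ⟨h1, h2⟩
    exact hw (T.mem_range_flatten_replicate h1 h2))] at ht'
  -- `g` is a logarithm of the Euler factor. The term of the power `k + 1` of `z` carries `1 / ((k +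
  -- 1) * z.length)`, so the powers of one representative give only `g / z.length`.
  have hlog : ∀ c : T.PrimitivePath, ∃ g : ℂ, Complex.exp g = eulerFactor U ρ u c.1 ∧
      ∀ z : List E, (z : Cycle E) = c.1 →
        HasSum (fun k : ℕ => cyclicWordTerm T.Follows G u (List.replicate (k + 1) z).flatten)
          (g / z.length) := by
    rintro ⟨c, ⟨hc0, hc⟩, hp⟩
    obtain ⟨z, rfl⟩ : ∃ z : List E, (z : Cycle E) = c := Quotient.exists_rep c
    have hne : z ≠ [] := fun h => hc0 (by simp [h])
    obtain ⟨z', hz'⟩ := hlift z hne hc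
    have hr := hroots z' (by rintro rfl; exact hne hz'.symm)
    have hzp : (z'.map fun e : s => G e) = z.map G := by rw [← hz', List.map_map]; rfl
    rw [hzp, show z'.length = z.length by rw [← hz', List.length_map]] at hr
    obtain ⟨g, hg1, hg2⟩ := Matrix.exists_hasSum_trace_pow _ hr
    refine ⟨g, ?_, fun y hy => ?_⟩
    · rw [hg2, eulerFactor_coe_eq_det b]
    · obtain ⟨n, hn, rfl⟩ := List.isRotated_iff_mod.1 (Cycle.coe_eq_coe.1 hy.symm)
      have := hg1.div_const (z.length : ℂ)
      simp only [← cyclicWordTerm_flatten_replicate G u hne hc] at this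
      simp only [← List.rotate_flatten_replicate z _ hn, cyclicWordTerm_rotate,
        List.length_rotate]
      exact this
  choose g hg1 hg2 using hlog
  have h1 : HasSum (fun x : Σ c : T.PrimitivePath, {z : List E // (z : Cycle E) = c.1} =>
      g x.1 / x.2.1.length) t :=
    ht'.sigma fun x => hg2 x.1 x.2.1 x.2.2
  -- An aperiodic cyclic word has `z.length` distinct representatives, which restore the full `g`.
  have h2 : HasSum g t := by
    refine h1.sigma fun c => ?_
    obtain ⟨c, ⟨hc0, hc⟩, hp⟩ := c
    obtain ⟨z, rfl⟩ : ∃ z : List E, (z : Cycle E) = c := Quotient.exists_rep c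
    have hne : z ≠ [] := fun h => hc0 (by simp [h])
    have hbij := bijective_rotate_of_rotationPeriod ((hasNoPeriods_coe_iff hne).1 hp) hne
    have hl : (z.length : ℂ) ≠ 0 := by simpa using hne
    rw [← (Equiv.ofBijective _ hbij).hasSum_iff]
    have hsum := hasSum_fintype fun _ : Fin z.length =>
      g ⟨(z : Cycle E), ⟨hc0, hc⟩, hp⟩ / (z.length : ℂ)
    rw [Finset.sum_const, Finset.card_univ, Fintype.card_fin, nsmul_eq_mul,
      mul_div_cancel₀ _ hl] at hsum
    convert hsum using 1
    funext k
    simp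
  have h3 := h2.cexp
  convert h3 using 1
  funext c
  exact (hg1 c).symm

end OrientedGraph

end EulerProduct

/-! ### Bass's identity: from edges to vertices. -/

section EdgeOperator

/-- Sylvester's identity. It serves twice: to pass from edges to vertices of `F`, and from boundary
points to vertices of `F`. -/
theorem LinearMap.det_id_sub_comp_comm {V W : Type*} [AddCommGroup V] [Module ℂ V]
    [AddCommGroup W] [Module ℂ W] [FiniteDimensional ℂ V] [FiniteDimensional ℂ W]
    (f : V →ₗ[ℂ] W) (g : W →ₗ[ℂ] V) :
    LinearMap.det (LinearMap.id - f ∘ₗ g) = LinearMap.det (LinearMap.id - g ∘ₗ f) := by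
  let b := Module.finBasis ℂ V
  let c := Module.finBasis ℂ W
  rw [← LinearMap.det_toMatrix c, ← LinearMap.det_toMatrix b, map_sub, map_sub,
    LinearMap.toMatrix_comp c b c, LinearMap.toMatrix_comp b c b, LinearMap.toMatrix_id,
    LinearMap.toMatrix_id, Matrix.det_one_sub_mul_comm]

theorem LinearMap.id_add_comp_id_sub_of_involution {W : Type*} [AddCommGroup W] [Module ℂ W]
    {J : W →ₗ[ℂ] W} (hJ : J ∘ₗ J = LinearMap.id) (u : ℂ) :
    (LinearMap.id + u • J) ∘ₗ (LinearMap.id - u • J) = (1 - u ^ 2) • LinearMap.id := by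
  simp only [LinearMap.add_comp, LinearMap.comp_sub, LinearMap.smul_comp, LinearMap.comp_smul, hJ,
    LinearMap.id_comp, LinearMap.comp_id]
  module

theorem LinearMap.exists_polynomial_eval_eq_det {W : Type*} [AddCommGroup W] [Module ℂ W]
    [FiniteDimensional ℂ W] (f g : W →ₗ[ℂ] W) : ∃ p : Polynomial ℂ,
    ∀ u : ℂ, p.eval u = LinearMap.det (LinearMap.id - u • f + u ^ 2 • g) := by
  let b := Module.finBasis ℂ W
  refine ⟨(1 - (Polynomial.X : Polynomial ℂ) • (LinearMap.toMatrix b b f).map Polynomial.C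
    + (Polynomial.X ^ 2 : Polynomial ℂ) • (LinearMap.toMatrix b b g).map Polynomial.C).det,
    fun u => ?_⟩
  rw [← Polynomial.coe_evalRingHom, RingHom.map_det, ← LinearMap.det_toMatrix b]
  congr 1
  ext i j
  by_cases h : i = j <;> (simp [h]; ring)

namespace OrientedGraph

variable {V E A v : Type*} [Group A] [AddCommGroup v] [Module ℂ v]
variable {T : OrientedGraph V E}

theorem d1_rev (e : E) : T.d1 (T.rev e) = T.d0 e := by rw [d1, T.rev_rev]

variable (T) in
/-- A choice of orientation of every edge, as a sign on the oriented edges. -/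
theorem exists_orientation : ∃ s : E → ℂ, ∀ e, s (T.rev e) = -s e ∧ s e * s e = 1 := by
  classical
  refine ⟨fun e => if WellOrderingRel e (T.rev e) then 1 else -1, fun e => ⟨?_, ?_⟩⟩
  · simp only [T.rev_rev]
    rcases trichotomous_of WellOrderingRel e (T.rev e) with h | h | h
    · rw [if_pos h, if_neg fun h' => asymm_of WellOrderingRel h h']
    · exact absurd h.symm (T.rev_ne e)
    · rw [if_pos h, if_neg fun h' => asymm_of WellOrderingRel h h', neg_neg]
  · dsimp only
    split_ifs <;> norm_num

namespace FinSubgraph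

variable (F : T.FinSubgraph)

theorem even_card_edges : Even F.edges.card := by
  have h : ∑ _e ∈ F.edges, (1 : ZMod 2) = 0 :=
    Finset.sum_involution (fun e _ => T.rev e) (fun _ _ => by decide) (fun e _ _ => T.rev_ne e)
      (fun e he => F.rev_mem e he) (fun e _ => T.rev_rev e)
  rw [Finset.sum_const, nsmul_one] at h
  exact (ZMod.natCast_eq_zero_iff_even).1 h

theorem finrank_edges_eq_two_mul_r1 [FiniteDimensional ℂ v] :
    Module.finrank ℂ (F.edges → v) = 2 * F.r1 v := by
  rw [r1, Nat.mul_div_cancel']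
  rcases F.even_card_edges with ⟨k, hk⟩
  rw [Module.finrank_pi_fintype]
  simp [hk, ← two_mul, mul_assoc]

/-- The values of a function at the ends of edges. -/
noncomputable def endValue (v : Type*) [AddCommGroup v] [Module ℂ v] :
    (F.verts → v) →ₗ[ℂ] (F.edges → v) :=
  LinearMap.pi fun e => LinearMap.proj ⟨T.d1 e.1, F.d1_mem e.2⟩

open Classical in
/-- The sum over the edges that start at a vertex, transported by the potentials. -/
noncomputable def startSum (U : E → A) (ρ : Representation ℂ A v) :
    (F.edges → v) →ₗ[ℂ] (F.verts → v) :=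
  LinearMap.pi fun x => ∑ e ∈ F.edges.attach with T.d0 e.1 = x, ρ (U e.1) ∘ₗ LinearMap.proj e

/-- The reversal of edges, transported by the potentials. -/
noncomputable def reversal (U : E → A) (ρ : Representation ℂ A v) :
    (F.edges → v) →ₗ[ℂ] (F.edges → v) :=
  LinearMap.pi fun e => ρ (U (T.rev e.1)) ∘ₗ LinearMap.proj ⟨T.rev e.1, F.rev_mem e.1 e.2⟩

/-- The operator on functions of edges that sums over the possible next edges of a path. -/
noncomputable def edgeOperator (U : E → A) (ρ : Representation ℂ A v) :
    (F.edges → v) →ₗ[ℂ] (F.edges → v) :=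
  F.endValue v ∘ₗ F.startSum U ρ - F.reversal U ρ

variable {U : E → A} (ρ : Representation ℂ A v)

theorem startSum_comp_endValue : F.startSum U ρ ∘ₗ F.endValue v = F.hecke U ρ := by
  refine LinearMap.ext fun f => funext fun x => ?_
  simp [startSum, endValue, FinSubgraph.hecke]

variable (hU : ∀ e, U (T.rev e) = (U e)⁻¹)
include hU

theorem rho_apply_rho_rev (e : E) (x : v) : ρ (U e) (ρ (U (T.rev e)) x) = x := by
  rw [hU, ← Module.End.mul_apply, ← map_mul, mul_inv_cancel, map_one, Module.End.one_apply]

theorem reversal_comp_reversal : F.reversal U ρ ∘ₗ F.reversal U ρ = LinearMap.id := by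
  refine LinearMap.ext fun f => funext fun e => ?_
  have := rho_apply_rho_rev ρ hU (T.rev e.1)
  rw [T.rev_rev] at this
  simp [reversal, T.rev_rev, this]

/-- Going along an edge and back has trivial transport and returns `f x`, once for each edge of `F`
that starts at `x`. -/
theorem startSum_comp_reversal_comp_endValue :
    F.startSum U ρ ∘ₗ F.reversal U ρ ∘ₗ F.endValue v = F.Q v + LinearMap.id := by
  classical
  refine LinearMap.ext fun f => funext fun x => ?_
  have h1 : ∀ e ∈ F.edges.attach.filter (fun e => T.d0 e.1 = x),
      ρ (U e.1) (ρ (U (T.rev e.1)) (f ⟨T.d1 (T.rev e.1), F.d1_mem (F.rev_mem e.1 e.2)⟩)) = f x := by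
    intro e he
    rw [rho_apply_rho_rev ρ hU]
    congr 1
    exact Subtype.ext ((d1_rev e.1).trans (Finset.mem_filter.1 he).2)
  have h2 : (F.edges.attach.filter (fun e => T.d0 e.1 = x)).card
      = (F.edges.filter fun e => T.d0 e = x).card := by
    rw [Finset.filter_attach (fun e => T.d0 e = x)]
    simp
  have h3 := Finset.sum_congr rfl h1
  rw [Finset.sum_const, h2] at h3
  simp only [startSum, reversal, endValue, FinSubgraph.Q, LinearMap.comp_apply, LinearMap.pi_apply,
    LinearMap.sum_apply, LinearMap.proj_apply, LinearMap.add_apply, Pi.add_apply,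
    LinearMap.smul_apply, LinearMap.id_apply]
  rw [sub_smul, one_smul, sub_add_cancel, Nat.cast_smul_eq_nsmul]
  convert h3

variable [FiniteDimensional ℂ v]

/-- Conjugation by an orientation sign turns the reversal `J` into `-J`, so `1 + uJ` and `1 - uJ`
have equal determinants, while their product is `1 - u²`. A sign remains undetermined. -/
theorem det_id_add_reversal_sq (u : ℂ) :
    LinearMap.det (LinearMap.id + u • F.reversal U ρ) ^ 2 = ((1 - u ^ 2) ^ F.r1 v) ^ 2 := by
  obtain ⟨s, hs⟩ := T.exists_orientation
  set J := F.reversal U ρ with hJ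
  set σ : (F.edges → v) →ₗ[ℂ] (F.edges → v) :=
    LinearMap.pi fun e => s e.1 • LinearMap.proj e with hσ
  have hσσ : σ ∘ₗ σ = LinearMap.id := by
    refine LinearMap.ext fun f => funext fun e => ?_
    simp [hσ, smul_smul, (hs e.1).2]
  have hσJ : σ ∘ₗ J ∘ₗ σ = -J := by
    refine LinearMap.ext fun f => funext fun e => ?_
    simp [hσ, hJ, reversal, smul_smul, (hs e.1).1, (hs e.1).2]
  have h1 : LinearMap.det (LinearMap.id + u • J) = LinearMap.det (LinearMap.id - u • J) := by
    have h2 : LinearMap.id - u • J = σ ∘ₗ (LinearMap.id + u • J) ∘ₗ σ := by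
      rw [LinearMap.add_comp, LinearMap.comp_add, LinearMap.id_comp, hσσ, LinearMap.smul_comp,
        LinearMap.comp_smul, hσJ, smul_neg, sub_eq_add_neg]
    have h3 : LinearMap.det σ * LinearMap.det σ = 1 := by
      rw [← LinearMap.det_comp, hσσ, LinearMap.det_id]
    rw [h2, LinearMap.det_comp, LinearMap.det_comp, mul_comm, mul_assoc, h3, mul_one]
  have h4 := LinearMap.id_add_comp_id_sub_of_involution (F.reversal_comp_reversal ρ hU) u
  calc _ = LinearMap.det (LinearMap.id + u • J) * LinearMap.det (LinearMap.id - u • J) := by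
        rw [sq, ← h1]
    _ = ((1 - u ^ 2) ^ F.r1 v) ^ 2 := by
        rw [← LinearMap.det_comp, h4, LinearMap.det_smul, LinearMap.det_id, mul_one,
          F.finrank_edges_eq_two_mul_r1, ← pow_mul, mul_comm]

/-- Both sides are continuous and equal 1 at `u = 0`, which excludes the opposite sign nearby. -/
theorem eventually_det_id_add_reversal : ∀ᶠ u in 𝓝 (0 : ℂ),
    LinearMap.det (LinearMap.id + u • F.reversal U ρ) = (1 - u ^ 2) ^ F.r1 v := by
  have hc : Continuous fun u : ℂ => LinearMap.det (LinearMap.id + u • F.reversal U ρ) := by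
    obtain ⟨p, hp⟩ := LinearMap.exists_polynomial_eval_eq_det (-F.reversal U ρ) 0
    convert p.continuous using 2 with u
    rw [hp, smul_neg, sub_neg_eq_add, smul_zero, add_zero]
  have hc' : Continuous fun u : ℂ => LinearMap.det (LinearMap.id + u • F.reversal U ρ)
      + (1 - u ^ 2) ^ F.r1 v := by fun_prop
  filter_upwards [hc'.continuousAt.eventually_ne (y := 0) (by simp)] with u hu
  rcases sq_eq_sq_iff_eq_or_eq_neg.1 (F.det_id_add_reversal_sq ρ hU u) with h | h
  · exact h
  · exact absurd (by rw [h]; ring) hu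

/-- The determinant of the edge operator in terms of an operator on the vertices. -/
theorem eventually_det_id_sub_edgeOperator : ∀ᶠ u in 𝓝 (0 : ℂ),
    LinearMap.det (LinearMap.id - u • F.edgeOperator U ρ) * (1 - u ^ 2) ^ F.r0 v
      = (1 - u ^ 2) ^ F.r1 v * LinearMap.det (F.delta U ρ u) := by
  have hev : ∀ᶠ u in 𝓝 (0 : ℂ), 1 - u ^ 2 ≠ 0 := by
    have hc : Continuous fun u : ℂ => 1 - u ^ 2 := by fun_prop
    exact hc.continuousAt.eventually_ne (by simp)
  filter_upwards [hev, F.eventually_det_id_add_reversal ρ hU] with u hu hdet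
  set J := F.reversal U ρ with hJ
  set P := F.startSum U ρ with hP
  set K := F.endValue v with hK
  -- This constant makes `(1 + uJ) N = uK`, so that the factor `1 + uJ` splits off from `1 - uW = 1
  -- + uJ - uKP`.
  set c : ℂ := u * (1 - u ^ 2)⁻¹ with hcdef
  have hc : c * (1 - u ^ 2) = u := by rw [hcdef]; field_simp
  set N : (F.verts → v) →ₗ[ℂ] (F.edges → v) := c • ((LinearMap.id - u • J) ∘ₗ K) with hN
  have h1 : LinearMap.id - u • F.edgeOperator U ρ
      = (LinearMap.id + u • J) ∘ₗ (LinearMap.id - N ∘ₗ P) := by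
    have h2 : (LinearMap.id + u • J) ∘ₗ N = u • K := by
      rw [hN, LinearMap.comp_smul, ← LinearMap.comp_assoc,
        LinearMap.id_add_comp_id_sub_of_involution (F.reversal_comp_reversal ρ hU),
        LinearMap.smul_comp, LinearMap.id_comp, smul_smul, hc]
    rw [LinearMap.comp_sub, ← LinearMap.comp_assoc, h2, edgeOperator, LinearMap.comp_id,
      LinearMap.smul_comp]
    module
  -- Here `PK` is `M̃₁` and `PJK` is `Q + 1`, and `(1 - u²) - u M̃₁ + u² (Q + 1)` is `Δ̃(u)`.
  have h3 : F.delta U ρ u = (1 - u ^ 2) • (LinearMap.id - P ∘ₗ N) := by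
    have h4 : P ∘ₗ N = c • (F.hecke U ρ - u • (F.Q v + LinearMap.id)) := by
      rw [hN, LinearMap.comp_smul, LinearMap.sub_comp, LinearMap.comp_sub, LinearMap.id_comp,
        LinearMap.smul_comp, LinearMap.comp_smul, F.startSum_comp_reversal_comp_endValue ρ hU,
        F.startSum_comp_endValue]
    rw [h4, smul_sub, smul_smul, mul_comm, hc, delta]
    module
  rw [h1, LinearMap.det_comp, hdet, LinearMap.det_id_sub_comp_comm, h3, LinearMap.det_smul, r0]
  ring

end FinSubgraph

end OrientedGraph

end EdgeOperator

/-! ### Rationality, uniqueness and values of the L-function. -/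

section LFunction

namespace OrientedGraph

variable {V E A v : Type*} [Group A] [AddCommGroup v] [Module ℂ v] [FiniteDimensional ℂ v]
variable {T : OrientedGraph V E} (F : T.FinSubgraph) {U : E → A} (ρ : Representation ℂ A v)

namespace FinSubgraph

-- The composite of `endValue` and `startSum` admits every edge starting where `e` ends; subtracting
-- the reversal removes just the backtracking one. So this operator has the transfer matrix of the
-- Euler product.
open Classical in
omit [FiniteDimensional ℂ v] in
theorem edgeOperator_single [DecidableEq F.edges] (e e' : F.edges) (x : v) :
    F.edgeOperator U ρ (Pi.single e' x) e = if T.Follows e.1 e'.1 then ρ (U e'.1) x else 0 := by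
  have h1 : F.endValue v (F.startSum U ρ (Pi.single e' x)) e
      = if T.d0 e'.1 = T.d1 e.1 then ρ (U e'.1) x else 0 := by
    simp only [endValue, startSum, LinearMap.pi_apply, LinearMap.proj_apply, LinearMap.sum_apply,
      LinearMap.comp_apply]
    rw [Finset.sum_filter, Finset.sum_eq_single e']
    · simp
    · intro b _ hb
      simp [hb]
    · simp
  have h2 : F.reversal U ρ (Pi.single e' x) e
      = if e'.1 = T.rev e.1 then ρ (U e'.1) x else 0 := by
    simp only [reversal, LinearMap.pi_apply, LinearMap.proj_apply, LinearMap.comp_apply,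
      Pi.single_apply, Subtype.ext_iff]
    split_ifs with h3 h4 h4
    · rw [h3]
    · exact absurd h3.symm h4
    · exact absurd h4.symm h3
    · simp
  rw [edgeOperator, LinearMap.sub_apply, Pi.sub_apply, LinearMap.comp_apply, h1, h2]
  by_cases h : e'.1 = T.rev e.1
  · have h3 : T.d0 e'.1 = T.d1 e.1 := by rw [h]; rfl
    have h4 : ¬ T.Follows e.1 e'.1 := fun h5 => h5.2 h
    rw [if_pos h3, if_pos h, if_neg h4, sub_self]
  · simp [Follows, h]

omit [FiniteDimensional ℂ v] in
theorem det_one_sub_comp_transferMatrix {ι : Type*} [Fintype ι] [DecidableEq ι]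
    [DecidableEq F.edges] (b : Module.Basis ι ℂ v) (u : ℂ) :
    (1 - u • Matrix.comp F.edges F.edges ι ι ℂ (transferMatrix
      (fun i j : F.edges => T.Follows i j)
      (fun e : F.edges => LinearMap.toMatrix b b (ρ (U e))))).det
      = LinearMap.det (LinearMap.id - u • F.edgeOperator U ρ) := by
  let B := (Pi.basis fun _ : F.edges => b).reindex (Equiv.sigmaEquivProd F.edges ι)
  rw [← LinearMap.det_toMatrix B, map_sub, map_smul, LinearMap.toMatrix_id]
  congr 3
  ext ⟨e, i⟩ ⟨e', j⟩
  have h1 : B (e', j) = Pi.single e' (b j) := by simp [B]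
  have h2 : ∀ f : F.edges → v, B.repr f (e, i) = b.repr (f e) i := by
    intro f
    simp [B]
  rw [LinearMap.toMatrix_apply, h1, h2, F.edgeOperator_single ρ, Matrix.comp_apply,
    transferMatrix, Matrix.of_apply]
  split_ifs
  · rw [LinearMap.toMatrix_apply]
  · simp

theorem exists_polynomial_eval_eq_det_delta (U : E → A) :
    ∃ p : Polynomial ℂ, ∀ u : ℂ, p.eval u = LinearMap.det (F.delta U ρ u) :=
  LinearMap.exists_polynomial_eval_eq_det (F.hecke U ρ) (F.Q v)

omit [FiniteDimensional ℂ v] in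
theorem det_delta_zero (U : E → A) : LinearMap.det (F.delta U ρ 0) = 1 := by
  simp [delta]

theorem finite_setOf_det_delta_eq_zero (U : E → A) :
    {u : ℂ | LinearMap.det (F.delta U ρ u) = 0}.Finite := by
  obtain ⟨p, hp⟩ := F.exists_polynomial_eval_eq_det_delta ρ U
  have hp0 : p ≠ 0 := by
    rintro rfl
    have := hp 0
    rw [F.det_delta_zero ρ U] at this
    simp at this
  refine (p.roots.toFinset.finite_toSet).subset fun u hu => ?_
  rw [Finset.mem_coe, Multiset.mem_toFinset, Polynomial.mem_roots hp0, Polynomial.IsRoot, hp]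
  exact hu

variable {F} in
theorem eventually_hasProd_eulerFactor_div (hF : F.IsReducedGraph)
    (hU : ∀ e, U (T.rev e) = (U e)⁻¹) :
    ∀ᶠ u in 𝓝 (0 : ℂ), HasProd (fun c : T.PrimitivePath => eulerFactor U ρ u c.1)
      ((1 - u ^ 2) ^ F.r0 v / ((1 - u ^ 2) ^ F.r1 v * LinearMap.det (F.delta U ρ u))) := by
  classical
  have hev : ∀ᶠ u in 𝓝 (0 : ℂ), 1 - u ^ 2 ≠ 0 := by
    have hc : Continuous fun u : ℂ => 1 - u ^ 2 := by fun_prop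
    exact hc.continuousAt.eventually_ne (by simp)
  filter_upwards [T.eventually_hasProd_eulerFactor (Module.finBasis ℂ v) U ρ F.edges hF.loops,
    F.eventually_det_id_sub_edgeOperator ρ hU, hev] with u h1 h2 h3
  rw [F.det_one_sub_comp_transferMatrix ρ _] at h1
  convert h1 using 1
  rw [← h2, mul_comm, div_mul_eq_div_div, div_self (pow_ne_zero _ h3), one_div]

end FinSubgraph

end OrientedGraph

/-- `RatFunc.eval` uses the reduced fraction. If its denominator vanished where `q` does not, its
numerator would vanish too, against coprimality. -/
theorem RatFunc.eval_eq_div_of_mul_eq {L : RatFunc ℂ} {p q : Polynomial ℂ}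
    (h : L * algebraMap _ _ q = algebraMap _ _ p) {u : ℂ} (hq : q.eval u ≠ 0) :
    L.eval (RingHom.id ℂ) u = p.eval u / q.eval u := by
  have h1 : L.num * q = p * L.denom := by
    rw [RatFunc.num_mul_eq_mul_denom_iff]
    · rw [← h, mul_div_assoc, div_self, mul_one]
      rw [Ne, FaithfulSMul.algebraMap_eq_zero_iff]
      rintro rfl
      simp at hq
    · rintro rfl
      simp at hq
  have h2 : L.denom.eval u ≠ 0 := by
    intro h0
    have h3 := congrArg (Polynomial.eval u) h1
    simp only [Polynomial.eval_mul, h0, mul_zero, mul_eq_zero, hq, or_false] at h3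
    obtain ⟨a, b, hab⟩ := L.isCoprime_num_denom
    have := congrArg (Polynomial.eval u) hab
    simp [h0, h3] at this
  have h3 := congrArg (Polynomial.eval u) h1
  simp only [Polynomial.eval_mul] at h3
  rw [RatFunc.eval, Polynomial.eval₂_id, Polynomial.eval₂_id, div_eq_div_iff h2 hq, h3]

/-- After cross-multiplication two polynomials agree at infinitely many points. The finitely many
zeros of the denominators are discarded, because evaluation there is only a default value. -/
theorem RatFunc.eq_of_eventually_eval_eq {L L' : RatFunc ℂ}
    (h : ∀ᶠ u in 𝓝 (0 : ℂ), L.eval (RingHom.id ℂ) u = L'.eval (RingHom.id ℂ) u) : L = L' := by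
  have hroots : {u : ℂ | (L.denom * L'.denom).eval u = 0}.Finite := by
    have h0 : L.denom * L'.denom ≠ 0 := mul_ne_zero L.denom_ne_zero L'.denom_ne_zero
    refine ((L.denom * L'.denom).roots.toFinset.finite_toSet).subset fun u hu => ?_
    simpa [h0] using hu
  have hinf : {u : ℂ | L.eval (RingHom.id ℂ) u = L'.eval (RingHom.id ℂ) u}.Infinite :=
    infinite_of_mem_nhds 0 h
  have h1 : L.num * L'.denom = L'.num * L.denom := by
    refine Polynomial.eq_of_infinite_eval_eq _ _ ((hinf.sdiff hroots).mono ?_)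
    rintro u ⟨h2, h3⟩
    simp only [Set.mem_ofPred_eq, Polynomial.eval_mul, mul_eq_zero, not_or] at h3
    simp only [Set.mem_ofPred_eq, RatFunc.eval, Polynomial.eval₂_id] at h2
    simpa only [Set.mem_ofPred_eq, Polynomial.eval_mul] using (div_eq_div_iff h3.1 h3.2).1 h2
  rw [← RatFunc.num_div_denom L, ← RatFunc.num_div_denom L', div_eq_div_iff, ← map_mul, ← map_mul,
    h1]
  · simpa using L.denom_ne_zero
  · simpa using L'.denom_ne_zero

namespace OrientedGraph

variable {V E A v : Type*} [Group A] [AddCommGroup v] [Module ℂ v]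
variable {T : OrientedGraph V E}

theorem IsLFunction.unique {U : E → A} {ρ : Representation ℂ A v} {L L' : RatFunc ℂ}
    (h : T.IsLFunction U ρ L) (h' : T.IsLFunction U ρ L') : L = L' :=
  RatFunc.eq_of_eventually_eval_eq (by filter_upwards [h, h'] with u hu hu' using hu.unique hu')

/-- The `L`-function, and its values outside `±1` and the zeros of the determinant. -/
theorem FinSubgraph.IsReducedGraph.exists_isLFunction [FiniteDimensional ℂ v] {F : T.FinSubgraph}
    (hF : F.IsReducedGraph) {U : E → A} (ρ : Representation ℂ A v)
    (hU : ∀ e, U (T.rev e) = (U e)⁻¹) :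
    ∃ L : RatFunc ℂ, T.IsLFunction U ρ L ∧ ∀ u : ℂ, u ^ 2 ≠ 1 →
      LinearMap.det (F.delta U ρ u) ≠ 0 → L.eval (RingHom.id ℂ) u =
        (1 - u ^ 2) ^ F.r0 v / ((1 - u ^ 2) ^ F.r1 v * LinearMap.det (F.delta U ρ u)) := by
  obtain ⟨p, hp⟩ := F.exists_polynomial_eval_eq_det_delta ρ U
  set q : Polynomial ℂ := (1 - Polynomial.X ^ 2) ^ F.r1 v * p with hq
  have hqe : ∀ u, q.eval u = (1 - u ^ 2) ^ F.r1 v * LinearMap.det (F.delta U ρ u) := by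
    intro u
    simp [hq, hp]
  have hq0 : q ≠ 0 := by
    intro h
    have := hqe 0
    rw [F.det_delta_zero ρ U, h] at this
    simp at this
  set L : RatFunc ℂ := algebraMap (Polynomial ℂ) _ ((1 - Polynomial.X ^ 2) ^ F.r0 v) / algebraMap _ _ q with hL
  have hLq : L * algebraMap _ _ q = algebraMap (Polynomial ℂ) _ ((1 - Polynomial.X ^ 2) ^ F.r0 v) := by
    rw [hL, div_mul_cancel₀]
    simpa using hq0
  have heval : ∀ u, q.eval u ≠ 0 → L.eval (RingHom.id ℂ) u =
      (1 - u ^ 2) ^ F.r0 v / ((1 - u ^ 2) ^ F.r1 v * LinearMap.det (F.delta U ρ u)) := by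
    intro u hu
    rw [RatFunc.eval_eq_div_of_mul_eq hLq hu, hqe]
    simp
  refine ⟨L, ?_, fun u h1 h2 => heval u ?_⟩
  · have hev : ∀ᶠ u in 𝓝 (0 : ℂ), q.eval u ≠ 0 := by
      refine q.continuous.continuousAt.eventually_ne ?_
      rw [hqe, F.det_delta_zero ρ U]
      simp
    filter_upwards [hev, FinSubgraph.eventually_hasProd_eulerFactor_div ρ hF hU] with u h1 h2
    rwa [heval u h1]
  · rw [hqe]
    exact mul_ne_zero (pow_ne_zero _ (sub_ne_zero.2 h1.symm)) h2

end OrientedGraph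

end LFunction

/-! ### The complement of a reduced graph is a forest. -/

section Branches

namespace OrientedGraph

variable {V E : Type*} {T : OrientedGraph V E}

theorem isPath_nil_iff {x y : V} : T.IsPath x [] y ↔ x = y := by
  constructor
  · intro h
    generalize hl : ([] : List E) = l at h
    cases h with
    | nil => rfl
    | snoc _ _ => simp at hl
  · rintro rfl
    exact IsPath.nil x

theorem isPath_append_singleton_iff {x y : V} {l : List E} {e : E} :
    T.IsPath x (l ++ [e]) y ↔
      T.IsPath x l (T.d0 e) ∧ (∀ e' ∈ l.getLast?, e ≠ T.rev e') ∧ y = T.d1 e := by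
  constructor
  · intro h
    generalize hl : l ++ [e] = l' at h
    cases h with
    | nil => simp at hl
    | snoc h1 h2 =>
      obtain ⟨rfl, h⟩ := List.append_inj' hl rfl
      obtain rfl : e = _ := by simpa using h
      exact ⟨h1, h2, rfl⟩
  · rintro ⟨h1, h2, rfl⟩
    exact IsPath.snoc h1 h2

theorem isPath_iff_of_ne_nil {x y : V} {l : List E} (hl : l ≠ []) :
    T.IsPath x l y ↔
      List.IsChain T.Follows l ∧ T.d0 (l.head hl) = x ∧ T.d1 (l.getLast hl) = y := by
  induction l using List.reverseRecOn generalizing y with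
  | nil => exact absurd rfl hl
  | append_singleton l e ih =>
    rw [isPath_append_singleton_iff]
    rcases eq_or_ne l [] with rfl | hne
    · simp [isPath_nil_iff, eq_comm]
    · rw [ih hne, List.isChain_append, List.head_append_of_ne_nil hne, List.getLast_append_singleton]
      simp only [List.getLast?_eq_some_getLast hne, Option.mem_def, Option.some.injEq,
        forall_eq', List.IsChain.singleton, List.head?_cons, Follows, true_and]
      constructor
      · rintro ⟨⟨h1, h2, h3⟩, h4, h5⟩
        exact ⟨⟨h1, h3.symm, h4⟩, h2, h5.symm⟩
      · rintro ⟨⟨h1, h3, h4⟩, h2, h5⟩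
        exact ⟨⟨h1, h2, h3.symm⟩, h4, h5.symm⟩

theorem Follows.reverse {e e' : E} (h : T.Follows e e') : T.Follows (T.rev e') (T.rev e) := by
  refine ⟨by rw [d1_rev]; exact h.1.symm, fun h' => ?_⟩
  rw [T.rev_rev] at h'
  exact h.2 h'.symm

theorem IsPath.reverse {x y : V} {l : List E} (h : T.IsPath x l y) :
    T.IsPath y (l.map T.rev).reverse x := by
  rcases eq_or_ne l [] with rfl | hne
  · rw [isPath_nil_iff] at h
    simpa [isPath_nil_iff] using h.symm
  · rw [isPath_iff_of_ne_nil hne] at h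
    rw [isPath_iff_of_ne_nil (by simpa using hne), List.isChain_reverse, List.isChain_map,
      List.head_reverse, List.getLast_reverse, List.getLast_map, List.head_map, d1_rev]
    exact ⟨h.1.imp fun _ _ h => h.reverse, h.2.2, h.2.1⟩

namespace FinSubgraph

variable {F : T.FinSubgraph}

/-- If the path backtracks at its closing point, deleting the first and last edges leaves a shorter
closed path. It cannot become empty this way, as that would mean an edge equal to its reverse or a
backtracking inside. -/
theorem IsReducedGraph.exists_mem_edges_of_closed (hF : F.IsReducedGraph) {l : List E}
    (hl : l ≠ []) (hc : List.IsChain T.Follows l)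
    (hclosed : T.d0 (l.head hl) = T.d1 (l.getLast hl)) : ∃ e ∈ l, e ∈ F.edges := by
  induction h : l.length using Nat.strong_induction_on generalizing l with
  | _ n ih =>
    by_cases hrev : l.head hl = T.rev (l.getLast hl)
    · obtain ⟨a, t, rfl⟩ := List.exists_cons_of_ne_nil hl
      rcases List.eq_nil_or_concat t with rfl | ⟨m, b, rfl⟩
      · exact absurd hrev.symm (T.rev_ne a)
      · simp only [List.concat_eq_append] at *
        have hab : a = T.rev b := by simpa using hrev
        rcases eq_or_ne m [] with rfl | hm
        · have h2 : T.Follows a b := by simpa using hc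
          exact absurd (by rw [hab, T.rev_rev]) h2.2
        · have hc1 : List.IsChain T.Follows (m ++ [b]) := (List.isChain_cons.1 hc).2
          have h1 := (List.isChain_cons.1 hc).1 (m.head hm) (by
            simp [List.head?_eq_some_head hm])
          have h2 := (List.isChain_append.1 hc1).2.2 (m.getLast hm) (by
            simp [List.getLast?_eq_some_getLast hm]) b (by simp)
          obtain ⟨e, he, heF⟩ := ih m.length (by simp at h; omega) hm hc1.left_of_append
            (by rw [h1.1, ← h2.1, hab, d1_rev]) rfl
          exact ⟨e, by simp [he], heF⟩
    · refine ⟨l.head hl, List.head_mem hl, hF.loops (l : Cycle E) ⟨by simpa using hl, ?_⟩ _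
        (by simp)⟩
      rw [Cycle.chain_ne_nil _ hl, List.isChain_cons]
      refine ⟨fun y hy => ?_, hc⟩
      rw [List.head?_eq_some_head hl, Option.mem_def, Option.some.injEq] at hy
      exact hy ▸ ⟨hclosed, hrev⟩

/-- Otherwise a path inside `F` would close `l` up to a proper closed path. There is no backtracking
at the joints, since one edge lies in `F` and the other does not. -/
theorem IsReducedGraph.eq_nil_of_isPath (hF : F.IsReducedGraph) {x y : V} {l : List E}
    (hx : x ∈ F.verts) (hy : y ∈ F.verts) (hp : T.IsPath x l y) (hl : ∀ e ∈ l, e ∉ F.edges) :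
    l = [] := by
  by_contra hne
  obtain ⟨m, hm, hmF⟩ := hF.connected y hy x hx
  rw [isPath_iff_of_ne_nil hne] at hp
  rcases eq_or_ne m [] with rfl | hmne
  · rw [isPath_nil_iff] at hm
    obtain ⟨e, he, heF⟩ := hF.exists_mem_edges_of_closed hne hp.1 (by rw [hp.2.1, hp.2.2, hm])
    exact hl e he heF
  · rw [isPath_iff_of_ne_nil hmne] at hm
    have hhead := hl _ (List.head_mem hne)
    have hlast := hl _ (List.getLast_mem hne)
    refine hhead (hF.loops ((l ++ m : List E) : Cycle E) ⟨by simp [hne], ?_⟩ _ (by simp))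
    rw [Cycle.chain_ne_nil _ (by simp [hne]), List.isChain_cons]
    refine ⟨fun z hz => ?_, ?_⟩
    · rw [List.head?_append_of_ne_nil _ hne, List.head?_eq_some_head hne, Option.mem_def,
        Option.some.injEq] at hz
      rw [List.getLast_append_of_ne_nil _ hmne, ← hz]
      refine ⟨by rw [hp.2.1, hm.2.2], fun h => hhead ?_⟩
      rw [h]
      exact F.rev_mem _ (hmF _ (List.getLast_mem hmne))
    · rw [List.isChain_append]
      refine ⟨hp.1, hm.1, fun a ha b hb => ?_⟩
      rw [List.getLast?_eq_some_getLast hne, Option.mem_def, Option.some.injEq] at ha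
      rw [List.head?_eq_some_head hmne, Option.mem_def, Option.some.injEq] at hb
      subst ha hb
      refine ⟨by rw [hp.2.2, hm.2.1], fun h => hlast ?_⟩
      have h1 := F.rev_mem _ (hmF _ (List.head_mem hmne))
      rwa [h, T.rev_rev] at h1

/-- Equal last edges are peeled off. If they differ, `l` followed by the reverse of `l'` is a
nonempty path outside `F` joining two vertices of `F`. -/
theorem IsReducedGraph.branch_path_unique (hF : F.IsReducedGraph) {x x' y : V} {l l' : List E}
    (hx : x ∈ F.verts) (hx' : x' ∈ F.verts) (hp : T.IsPath x l y) (hp' : T.IsPath x' l' y)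
    (hl : ∀ e ∈ l, e ∉ F.edges) (hl' : ∀ e ∈ l', e ∉ F.edges) : x = x' ∧ l = l' := by
  induction l using List.reverseRecOn generalizing y l' with
  | nil =>
    obtain rfl := isPath_nil_iff.1 hp
    obtain rfl := hF.eq_nil_of_isPath hx' hx hp' hl'
    exact ⟨(isPath_nil_iff.1 hp').symm, rfl⟩
  | append_singleton l e ih =>
    rcases List.eq_nil_or_concat l' with rfl | ⟨l', e', rfl⟩
    · obtain rfl := isPath_nil_iff.1 hp'
      exact absurd (hF.eq_nil_of_isPath hx hx' hp hl) (by simp)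
    · simp only [List.concat_eq_append] at *
      have h1 := isPath_append_singleton_iff.1 hp
      have h1' := isPath_append_singleton_iff.1 hp'
      by_cases hee : e = e'
      · subst hee
        obtain ⟨rfl, rfl⟩ := ih h1.1 h1'.1 (fun a ha => hl a (by simp [ha]))
          (fun a ha => hl' a (by simp [ha]))
        exact ⟨rfl, rfl⟩
      · exfalso
        have hr := hp'.reverse
        have hne : (l ++ [e] : List E) ≠ [] := by simp
        have hne' : ((l' ++ [e']).map T.rev).reverse ≠ [] := by simp
        rw [isPath_iff_of_ne_nil hne] at hp
        rw [isPath_iff_of_ne_nil hne'] at hr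
        have hjoin : T.IsPath x ((l ++ [e]) ++ ((l' ++ [e']).map T.rev).reverse) x' := by
          rw [isPath_iff_of_ne_nil (by simp), List.isChain_append]
          refine ⟨⟨hp.1, hr.1, fun a ha b hb => ?_⟩, ?_, ?_⟩
          · obtain rfl : e = a := by simpa using ha
            obtain rfl : T.rev e' = b := by simpa using hb
            refine ⟨?_, fun h => hee ?_⟩
            · rw [← h1.2.2, h1'.2.2]
              rfl
            · rw [← T.rev_rev e, ← h, T.rev_rev]
          · rw [List.head_append_of_ne_nil hne]
            exact hp.2.1
          · rw [List.getLast_append_of_ne_nil _ hne']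
            exact hr.2.2
        refine absurd (hF.eq_nil_of_isPath hx hx' hjoin fun a ha => ?_) (by simp)
        rcases List.mem_append.1 ha with ha | ha
        · exact hl a ha
        · rw [List.mem_reverse, List.mem_map] at ha
          obtain ⟨c, hc, rfl⟩ := ha
          intro h
          have := F.rev_mem _ h
          rw [T.rev_rev] at this
          exact hl' c hc this

/-- The vertices reached in this way are closed under steps: a step ends in `F`, prolongs the path,
or retraces its last edge. `hconn` expresses connectedness of the whole graph. -/
theorem IsReducedGraph.exists_branch_path (hF : F.IsReducedGraph)
    (hconn : ∀ R : Set V, R.Nonempty → (∀ e, T.d0 e ∈ R → T.d1 e ∈ R) → R = Set.univ) (y : V) :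
    ∃ x ∈ F.verts, ∃ l, T.IsPath x l y ∧ ∀ e ∈ l, e ∉ F.edges := by
  suffices h : {y | ∃ x ∈ F.verts, ∃ l, T.IsPath x l y ∧ ∀ e ∈ l, e ∉ F.edges} = Set.univ from
    Set.eq_univ_iff_forall.1 h y
  refine hconn _ ?_ ?_
  · obtain ⟨x, hx⟩ := hF.nonempty
    exact ⟨x, x, hx, [], IsPath.nil x, by simp⟩
  · rintro e ⟨x, hx, l, hp, hl⟩
    by_cases he : e ∈ F.edges
    · exact ⟨_, F.d1_mem he, [], IsPath.nil _, by simp⟩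
    · by_cases hrev : ∀ e' ∈ l.getLast?, e ≠ T.rev e'
      · refine ⟨x, hx, l ++ [e], IsPath.snoc hp hrev, ?_⟩
        intro a ha
        rcases List.mem_append.1 ha with ha | ha
        · exact hl a ha
        · rw [List.mem_singleton.1 ha]
          exact he
      · push Not at hrev
        obtain ⟨e', he', rfl⟩ := hrev
        rcases List.eq_nil_or_concat l with rfl | ⟨l, b, rfl⟩
        · simp at he'
        · simp only [List.concat_eq_append] at *
          obtain rfl : b = e' := by simpa using he'
          refine ⟨x, hx, l, ?_, fun a ha => hl a (by simp [ha])⟩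
          rw [d1_rev]
          exact (isPath_append_singleton_iff.1 hp).1

theorem mem_boundary_of_isPath {x y : V} {l : List E} (hx : x ∈ F.verts) (hp : T.IsPath x l y)
    (hne : l ≠ []) (hl : ∀ e ∈ l, e ∉ F.edges) : x ∈ F.boundary :=
  ⟨hx, l.head hne, ((isPath_iff_of_ne_nil hne).1 hp).2.1, hl _ (List.head_mem hne)⟩

end FinSubgraph

end OrientedGraph

end Branches

/-! ### Reduction of the scattering problem to `F`. -/

section Scattering

namespace OrientedGraph

variable {V E A v : Type*} [Group A] [AddCommGroup v] [Module ℂ v]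
variable {T : OrientedGraph V E} {U : E → A} {ρ : Representation ℂ A v}

theorem exists_finset_edges_from {p : ℕ} {x : V} (hval : T.valency x = p + 1) :
    ∃ S : Finset E, (∀ e, e ∈ S ↔ T.d0 e = x) ∧ S.card = p + 1 ∧
      ∀ (U : E → A) (ρ : Representation ℂ A v) (ψ : V → v),
        T.hecke U ρ ψ x = ∑ e ∈ S, ρ (U e) (ψ (T.d1 e)) := by
  have hfin : Finite {e : E // T.d0 e = x} := Nat.finite_of_card_ne_zero (by
    rw [← valency, hval]
    omega)
  have hfin' : {e : E | T.d0 e = x}.Finite := hfin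
  refine ⟨hfin'.toFinset, fun e => by simp, ?_, fun U ρ ψ => ?_⟩
  · rw [← hval, valency, ← Set.ncard_eq_toFinset_card _ hfin']
    rfl
  · rw [hecke, finsum_subtype_eq_finsum_cond (f := fun e => ρ (U e) (ψ (T.d1 e)))
      (fun e => T.d0 e = x)]
    exact finsum_mem_eq_finite_toFinset_sum _ hfin'

namespace FinSubgraph

variable {F : T.FinSubgraph}

/-- One edge leads back and `p` lead outward, so at distance `n + 1` the equation is the quadratic
equation of `α±` multiplied by `α± ^ n`. -/
theorem laplacian_eq_of_branch {p : ℕ} {lam αp αm : ℂ} {x y : V} {l : List E}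
    (hU : ∀ e, U (T.rev e) = (U e)⁻¹) (hval : T.valency y = p + 1)
    (hp : (p : ℂ) * αp ^ 2 - (p + 1 + lam) * αp + 1 = 0)
    (hm : (p : ℂ) * αm ^ 2 - (p + 1 + lam) * αm + 1 = 0)
    {ψ : V → v} {a b : v}
    (hψ : ∀ (l : List E) (y : V), T.IsPath x l y → (∀ e ∈ l, e ∉ F.edges) →
      ψ y = ρ (l.map U).prod⁻¹ (αp ^ l.length • a - αm ^ l.length • b))
    (hy : y ∉ F.verts) (hl : T.IsPath x l y) (hlF : ∀ e ∈ l, e ∉ F.edges) (hne : l ≠ []) :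
    T.laplacian U ρ ψ y = lam • ψ y := by
  classical
  obtain ⟨l, e₀, rfl⟩ := (List.eq_nil_or_concat l).resolve_left hne
  simp only [List.concat_eq_append] at *
  obtain ⟨h0, h1, rfl⟩ := isPath_append_singleton_iff.1 hl
  obtain ⟨S, hS, hcard, hhecke⟩ := exists_finset_edges_from (A := A) (v := v) hval
  have hrev : T.rev e₀ ∈ S := (hS _).2 rfl
  have hψ0 := hψ l _ h0 fun e he => hlF e (by simp [he])
  have hψ1 := hψ _ _ hl hlF
  set P := (l.map U).prod with hP
  have hP1 : ((l ++ [e₀]).map U).prod = P * U e₀ := by simp [hP]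
  have hback : ρ (U (T.rev e₀)) (ψ (T.d1 (T.rev e₀)))
      = ρ (P * U e₀)⁻¹ (αp ^ l.length • a - αm ^ l.length • b) := by
    rw [d1_rev, hψ0, hU, ← Module.End.mul_apply, ← map_mul, mul_inv_rev]
  have hforth : ∀ e ∈ S.erase (T.rev e₀), ρ (U e) (ψ (T.d1 e))
      = ρ (P * U e₀)⁻¹ (αp ^ (l.length + 2) • a - αm ^ (l.length + 2) • b) := by
    intro e he
    rw [Finset.mem_erase, hS] at he
    have heF : e ∉ F.edges := fun h => hy (he.2 ▸ F.d0_mem e h)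
    have hpath : T.IsPath x (l ++ [e₀] ++ [e]) (T.d1 e) :=
      isPath_append_singleton_iff.2 ⟨he.2 ▸ hl, by simpa using he.1, rfl⟩
    rw [hψ _ _ hpath fun c hc => ?_]
    · rw [← Module.End.mul_apply, ← map_mul, List.map_append, List.prod_append, hP1]
      simp
    · rcases List.mem_append.1 hc with hc | hc
      · exact hlF c hc
      · rw [List.mem_singleton.1 hc]
        exact heF
  rw [laplacian, hhecke, hval, ← Finset.add_sum_erase S _ hrev, hback,
    Finset.sum_congr rfl hforth, Finset.sum_const, Finset.card_erase_of_mem hrev, hcard, hψ1, hP1,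
    List.length_append, List.length_singleton, sub_eq_iff_eq_add, ← add_smul, ← LinearMap.map_smul,
    ← Nat.cast_smul_eq_nsmul ℂ, ← LinearMap.map_smul, ← map_add, Nat.add_sub_cancel]
  congr 1
  have hp' : αp ^ l.length + p * αp ^ (l.length + 2)
      = (lam + ((p + 1 : ℕ) : ℂ)) * αp ^ (l.length + 1) := by
    push_cast
    linear_combination αp ^ l.length * hp
  have hm' : αm ^ l.length + p * αm ^ (l.length + 2)
      = (lam + ((p + 1 : ℕ) : ℂ)) * αm ^ (l.length + 1) := by
    push_cast
    linear_combination αm ^ l.length * hm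
  rw [smul_sub, smul_sub, smul_smul, smul_smul, smul_smul, smul_smul, ← hp', ← hm']
  module

/-- The potential of a branch edge cancels, so the `p - Q(x)` edges leaving `F` at `x` all
contribute the same vector. -/
theorem hecke_eq_of_mem_verts {p : ℕ} {αp αm : ℂ}
    {x : V} (hx : x ∈ F.verts) (hval : T.valency x = p + 1) {ψ : V → v} {a b : v}
    (hψ : ∀ e, T.d0 e = x → e ∉ F.edges → ψ (T.d1 e) = ρ (U e)⁻¹ (αp • a - αm • b)) :
    T.hecke U ρ ψ x = F.hecke U ρ (fun x => ψ x) ⟨x, hx⟩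
      + ((p : ℂ) • (LinearMap.id : (F.verts → v) →ₗ[ℂ] (F.verts → v)) - F.Q v)
        (fun _ => αp • a - αm • b) ⟨x, hx⟩ := by
  classical
  obtain ⟨S, hS, hcard, hhecke⟩ := exists_finset_edges_from (A := A) (v := v) hval
  have hin : S.filter (· ∈ F.edges) = F.edges.filter fun e => T.d0 e = x := by
    ext e
    simp [hS, and_comm]
  have hout : ∀ e ∈ S.filter (· ∉ F.edges), ρ (U e) (ψ (T.d1 e)) = αp • a - αm • b := by
    intro e he
    rw [Finset.mem_filter, hS] at he
    rw [hψ e he.1 he.2, ← Module.End.mul_apply, ← map_mul, mul_inv_cancel, map_one,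
      Module.End.one_apply]
  have hcount : ((S.filter (· ∉ F.edges)).card : ℂ)
      = p - (((F.edges.filter fun e => T.d0 e = x).card : ℂ) - 1) := by
    have h1 := Finset.card_filter_add_card_filter_not (s := S) (· ∈ F.edges)
    rw [hin, hcard] at h1
    have h2 : (((F.edges.filter fun e => T.d0 e = x).card : ℂ)
      + (S.filter (· ∉ F.edges)).card) = p + 1 := by exact_mod_cast h1
    linear_combination h2
  have hheckeF : F.hecke U ρ (fun x => ψ x) ⟨x, hx⟩
      = ∑ e ∈ F.edges.filter fun e => T.d0 e = x, ρ (U e) (ψ (T.d1 e)) := by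
    simp only [FinSubgraph.hecke, LinearMap.pi_apply, LinearMap.sum_apply, LinearMap.comp_apply,
      LinearMap.proj_apply]
    rw [Finset.sum_filter, Finset.sum_filter, ← Finset.sum_attach F.edges]
  rw [hhecke, ← Finset.sum_filter_add_sum_filter_not S (· ∈ F.edges), hin, hheckeF,
    Finset.sum_congr rfl hout, Finset.sum_const, ← Nat.cast_smul_eq_nsmul ℂ, hcount]
  congr 1
  simp only [FinSubgraph.Q, LinearMap.sub_apply, LinearMap.smul_apply, LinearMap.id_apply,
    Pi.sub_apply, Pi.smul_apply, LinearMap.pi_apply, LinearMap.proj_apply]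
  rw [← sub_smul]

variable (F) in
/-- The number of branches at each vertex, as an operator. -/
noncomputable def branchCount (p : ℕ) (v : Type*) [AddCommGroup v] [Module ℂ v] :
    (F.verts → v) →ₗ[ℂ] (F.verts → v) := (p : ℂ) • LinearMap.id - F.Q v

theorem branchCount_apply_congr (p : ℕ) {f g : F.verts → v} {x : F.verts} (h : f x = g x) :
    F.branchCount p v f x = F.branchCount p v g x := by
  simp [branchCount, FinSubgraph.Q, h]

theorem branchCount_apply_of_notMem_boundary {p : ℕ} (f : F.verts → v) {x : F.verts}
    (hval : T.valency x.1 = p + 1) (hx : x.1 ∉ F.boundary) : F.branchCount p v f x = 0 := by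
  classical
  obtain ⟨S, hS, hcard, -⟩ := exists_finset_edges_from (A := Unit) (v := ℂ) hval
  have h : F.edges.filter (fun e => T.d0 e = x) = S := by
    ext e
    simp only [Finset.mem_filter, hS, and_iff_right_iff_imp]
    intro he
    by_contra heF
    exact hx ⟨x.2, e, he, heF⟩
  have h2 : ((F.edges.filter fun e => T.d0 e = x).card : ℂ) = p + 1 := by
    rw [h, hcard]
    push_cast
    rfl
  simp only [branchCount, FinSubgraph.Q, LinearMap.sub_apply, LinearMap.smul_apply,
    LinearMap.id_apply, Pi.sub_apply, Pi.smul_apply, LinearMap.pi_apply, LinearMap.proj_apply]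
  rw [← sub_smul]
  convert zero_smul ℂ (f x)
  rw [sub_eq_zero, eq_comm, sub_eq_iff_eq_add, ← h2]

variable (F) in
/-- Restriction of functions to the boundary points. -/
noncomputable def boundaryRestrict (v : Type*) [AddCommGroup v] [Module ℂ v] :
    (F.verts → v) →ₗ[ℂ] (F.boundary → v) :=
  LinearMap.funLeft ℂ v fun x : F.boundary => (⟨x.1, x.2.1⟩ : F.verts)

open Classical in
variable (F) in
/-- Extension by zero of functions on the boundary points. -/
noncomputable def boundaryExtend (v : Type*) [AddCommGroup v] [Module ℂ v] :
    (F.boundary → v) →ₗ[ℂ] (F.verts → v) :=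
  LinearMap.pi fun x => if h : x.1 ∈ F.boundary then LinearMap.proj ⟨x.1, h⟩ else 0

theorem boundaryExtend_apply (a : F.boundary → v) (x : F.boundary) :
    F.boundaryExtend v a ⟨x.1, x.2.1⟩ = a x := by
  simp [boundaryExtend]

theorem boundaryRestrict_apply (f : F.verts → v) (x : F.boundary) :
    F.boundaryRestrict v f x = f ⟨x.1, x.2.1⟩ := rfl

/-- No branch starts at an interior vertex, so the operator sees boundary values only. This is what
allows `det S` to be computed on all vertices of `F`. -/
theorem branchCount_boundaryExtend_boundaryRestrict {p : ℕ}
    (hval : ∀ x, T.valency x = p + 1) (f : F.verts → v) :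
    F.branchCount p v (F.boundaryExtend v (F.boundaryRestrict v f)) = F.branchCount p v f := by
  funext x
  by_cases hx : x.1 ∈ F.boundary
  · exact branchCount_apply_congr p (boundaryExtend_apply _ ⟨x.1, hx⟩)
  · rw [branchCount_apply_of_notMem_boundary _ (hval x) hx,
      branchCount_apply_of_notMem_boundary _ (hval x) hx]

/-- On the branches the equation is automatic, so only the equations at vertices of `F` remain.
Conversely, `f` is continued along the unique branch paths. -/
theorem IsReducedGraph.isScatteringSolution_iff (hF : F.IsReducedGraph)
    (hconn : ∀ R : Set V, R.Nonempty → (∀ e, T.d0 e ∈ R → T.d1 e ∈ R) → R = Set.univ)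
    {p : ℕ} (hval : ∀ x, T.valency x = p + 1) (hU : ∀ e, U (T.rev e) = (U e)⁻¹)
    {lam αp αm : ℂ}
    (hp : (p : ℂ) * αp ^ 2 - (p + 1 + lam) * αp + 1 = 0)
    (hm : (p : ℂ) * αm ^ 2 - (p + 1 + lam) * αm + 1 = 0) (a b : F.boundary → v) :
    F.IsScatteringSolution U ρ lam αp αm a b ↔
      ∃ f : F.verts → v, F.boundaryRestrict v f = a - b ∧
        F.hecke U ρ f + F.branchCount p v
          (αp • F.boundaryExtend v a - αm • F.boundaryExtend v b) = ((p : ℂ) + 1 + lam) • f := by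
  classical
  set a' := F.boundaryExtend v a with ha'
  set b' := F.boundaryExtend v b with hb'
  have hinner : ∀ ψ : V → v, (∀ (x : F.boundary) (l : List E) (y : V), T.IsPath x l y →
      (∀ e ∈ l, e ∉ F.edges) →
        ψ y = ρ (l.map U).prod⁻¹ (αp ^ l.length • a x - αm ^ l.length • b x)) →
      ∀ x : F.verts, T.hecke U ρ ψ x = F.hecke U ρ (fun x => ψ x) x
        + F.branchCount p v (αp • a' - αm • b') x := by
    intro ψ hψ x
    rw [hecke_eq_of_mem_verts x.2 (hval x) (a := a' x) (b := b' x) fun e he heF => ?_]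
    · congr 1
    · have hx : x.1 ∈ F.boundary := ⟨x.2, e, he, heF⟩
      have h1 := hψ ⟨x.1, hx⟩ [e] (T.d1 e)
        ((isPath_iff_of_ne_nil (by simp)).2 (by simp [he])) (by simpa using heF)
      rw [h1, ha', hb', boundaryExtend_apply a ⟨x.1, hx⟩, boundaryExtend_apply b ⟨x.1, hx⟩]
      simp
  constructor
  · rintro ⟨ψ, hlap, hψ⟩
    refine ⟨fun x => ψ x, ?_, ?_⟩
    · funext x
      have := hψ x [] x (IsPath.nil x.1) (by simp)
      simpa [boundaryRestrict_apply] using this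
    · funext x
      have h1 := hlap x
      rw [laplacian, hinner ψ hψ x, hval, sub_eq_iff_eq_add, ← add_smul] at h1
      rw [Pi.add_apply, h1, Pi.smul_apply]
      congr 1
      push_cast
      ring
  · rintro ⟨f, hf, heq⟩
    choose root hroot path hpath hpathF using hF.exists_branch_path hconn
    -- The default 0 plays no role: the root of a vertex outside `F` is always a boundary point.
    let a₀ : V → v := fun x => if h : x ∈ F.boundary then a ⟨x, h⟩ else 0
    let b₀ : V → v := fun x => if h : x ∈ F.boundary then b ⟨x, h⟩ else 0
    let ψ : V → v := fun y => if h : y ∈ F.verts then f ⟨y, h⟩ else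
      ρ ((path y).map U).prod⁻¹
        (αp ^ (path y).length • a₀ (root y) - αm ^ (path y).length • b₀ (root y))
    have hψ : ∀ (x : F.boundary) (l : List E) (y : V), T.IsPath x l y →
        (∀ e ∈ l, e ∉ F.edges) →
          ψ y = ρ (l.map U).prod⁻¹ (αp ^ l.length • a x - αm ^ l.length • b x) := by
      intro x l y hl hlF
      by_cases hy : y ∈ F.verts
      · obtain rfl := hF.eq_nil_of_isPath x.2.1 hy hl hlF
        obtain rfl := isPath_nil_iff.1 hl
        have h1 := congrFun hf x
        rw [boundaryRestrict_apply] at h1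
        simp [ψ, hy, h1]
      · obtain ⟨h1, h2⟩ := hF.branch_path_unique (hroot y) x.2.1 (hpath y) hl (hpathF y) hlF
        have hx : root y ∈ F.boundary := h1 ▸ x.2
        simp only [ψ, hy, dite_false, h1, h2, a₀, b₀, x.2, dite_true]
    refine ⟨ψ, fun y => ?_, hψ⟩
    by_cases hy : y ∈ F.verts
    · have h1 : (fun x : F.verts => ψ x) = f := by
        funext x
        simp [ψ]
      have h2 := congrFun heq ⟨y, hy⟩
      rw [laplacian, hinner ψ hψ ⟨y, hy⟩, h1, hval, sub_eq_iff_eq_add, ← add_smul]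
      rw [Pi.add_apply] at h2
      rw [h2, Pi.smul_apply]
      simp only [ψ, hy, dite_true]
      congr 1
      push_cast
      ring
    · have hne : path y ≠ [] := by
        intro h
        have := hpath y
        rw [h, isPath_nil_iff] at this
        exact hy (this ▸ hroot y)
      have hx := mem_boundary_of_isPath (hroot y) (hpath y) hne (hpathF y)
      exact laplacian_eq_of_branch hU (hval y) hp hm (hψ ⟨root y, hx⟩) hy (hpath y)
        (hpathF y) hne

end FinSubgraph

end OrientedGraph

end Scattering

/-! ### Valency and connectedness of the quotient of the tree. -/

section FactorizedTree

variable {X : Type*} {D : SimpleGraph X} {Γ : Subgroup (D ≃g D)}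

/-- Freeness makes the star of `x` map bijectively onto the star of its orbit: a motion that
identifies two edges from `x` fixes `x`, hence is the identity. -/
theorem factorizedTree_valency [D.LocallyFinite] {d : ℕ} (hreg : D.IsRegularOfDegree d)
    (hΓ : ActsFreely Γ) (x : Quotient (vertexSetoid Γ)) : (factorizedTree Γ hΓ).valency x = d := by
  obtain ⟨x, rfl⟩ := Quotient.exists_rep x
  let φ : D.neighborSet x →
      {e : Quotient (edgeSetoid Γ) // (factorizedTree Γ hΓ).d0 e = Quotient.mk _ x} :=
    fun y => ⟨Quotient.mk _ ⟨(x, y.1), y.2⟩, rfl⟩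
  have hφ : Function.Bijective φ := by
    constructor
    · intro y z hyz
      obtain ⟨γ, hγ, h1, h2⟩ := Quotient.exact (Subtype.ext_iff.1 hyz)
      have hγ1 : γ = 1 := by
        by_contra hne
        exact hΓ.no_fixed_vertex γ hγ hne x h1
      subst hγ1
      exact Subtype.ext h2
    · rintro ⟨e, he⟩
      obtain ⟨e, rfl⟩ := Quotient.exists_rep e
      obtain ⟨γ, hγ, h1⟩ := Quotient.exact he
      have hadj : D.Adj x (γ e.snd) := by
        have := γ.map_rel_iff.2 e.adj
        rwa [h1] at this
      refine ⟨⟨γ e.snd, hadj⟩, Subtype.ext (Quotient.sound ?_)⟩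
      exact (edgeSetoid Γ).symm ⟨γ, hγ, h1, rfl⟩
  rw [OrientedGraph.valency, ← Nat.card_congr (Equiv.ofBijective φ hφ), Nat.card_eq_fintype_card,
    SimpleGraph.card_neighborSet_eq_degree, hreg x]

theorem factorizedTree_connected (hD : D.Connected) (hΓ : ActsFreely Γ)
    (R : Set (Quotient (vertexSetoid Γ))) (hR : R.Nonempty)
    (hstep : ∀ e, (factorizedTree Γ hΓ).d0 e ∈ R → (factorizedTree Γ hΓ).d1 e ∈ R) :
    R = Set.univ := by
  obtain ⟨x, hx⟩ := hR
  obtain ⟨x, rfl⟩ := Quotient.exists_rep x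
  refine Set.eq_univ_of_forall fun y => ?_
  obtain ⟨y, rfl⟩ := Quotient.exists_rep y
  obtain ⟨w⟩ := hD.preconnected x y
  induction w with
  | nil => exact hx
  | cons h _ ih => exact ih (hstep (Quotient.mk _ ⟨(_, _), h⟩) hx)

end FactorizedTree

/-! ### The scattering operator and its determinant. -/

section ScatteringOperator

namespace OrientedGraph

variable {V E A v : Type*} [Group A] [AddCommGroup v] [Module ℂ v]
variable {T : OrientedGraph V E} {F : T.FinSubgraph} {U : E → A} {ρ : Representation ℂ A v}

namespace FinSubgraph

/-- Exchanging the roots exchanges the amplitudes up to sign, so the operator built for the swapped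
roots is the inverse of `S`. -/
theorem isScatteringSolution_swap {lam αp αm : ℂ} {a b : F.boundary → v} :
    F.IsScatteringSolution U ρ lam αp αm a b ↔ F.IsScatteringSolution U ρ lam αm αp (-b) (-a) := by
  have h : ∀ (n : ℕ) (x : F.boundary),
      αm ^ n • (-b) x - αp ^ n • (-a) x = αp ^ n • a x - αm ^ n • b x := by
    intro n x
    rw [Pi.neg_apply, Pi.neg_apply]
    module
  simp only [IsScatteringSolution, h]

theorem IsReducedGraph.exists_scattering_operator [FiniteDimensional ℂ v]
    (hF : F.IsReducedGraph)
    (hconn : ∀ R : Set V, R.Nonempty → (∀ e, T.d0 e ∈ R → T.d1 e ∈ R) → R = Set.univ)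
    {p : ℕ} (hval : ∀ x, T.valency x = p + 1) (hU : ∀ e, U (T.rev e) = (U e)⁻¹)
    {lam αp αm : ℂ} (hprod : p * αp * αm = 1) (hsum : p * (αp + αm) = p + 1 + lam)
    (hdet : LinearMap.det (F.delta U ρ αp) ≠ 0) :
    ∃ S : (F.boundary → v) →ₗ[ℂ] (F.boundary → v),
      (∀ a b : F.boundary → v, F.IsScatteringSolution U ρ lam αp αm a b ↔ a = S b) ∧
      LinearMap.det S = (αp / αm) ^ F.r0 v *
        (LinearMap.det (F.delta U ρ αm) / LinearMap.det (F.delta U ρ αp)) := by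
  have hp : (p : ℂ) * αp ^ 2 - (p + 1 + lam) * αp + 1 = 0 := by
    linear_combination (-αp) * (-hsum) - hprod
  have hm : (p : ℂ) * αm ^ 2 - (p + 1 + lam) * αm + 1 = 0 := by
    linear_combination (-αm) * (-hsum) - hprod
  have hαp : αp ≠ 0 := by
    rintro rfl
    simp at hprod
  have hαm : αm ≠ 0 := by
    rintro rfl
    simp at hprod
  set Δ := F.delta U ρ αp with hΔ
  set B := F.branchCount p v with hB
  set κ : ℂ := αp * (αp - αm) with hκ
  set N : (F.boundary → v) →ₗ[ℂ] (F.verts → v) := κ • (B ∘ₗ F.boundaryExtend v) with hN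
  have hfd : FiniteDimensional ℂ (F.boundary → v) :=
    FiniteDimensional.of_surjective (F.boundaryRestrict v)
      (LinearMap.funLeft_surjective_of_injective _ _ _ fun x y h =>
        Subtype.ext (congrArg (fun z : F.verts => z.1) h))
  obtain ⟨Δi, hΔ1, hΔ2⟩ : ∃ Δi : (F.verts → v) →ₗ[ℂ] (F.verts → v),
      Δ ∘ₗ Δi = LinearMap.id ∧ Δi ∘ₗ Δ = LinearMap.id := by
    obtain ⟨w, hw⟩ := (LinearMap.isUnit_iff_isUnit_det Δ).2 hdet.isUnit
    exact ⟨w.inv, by rw [← hw]; exact w.mul_inv, by rw [← hw]; exact w.inv_mul⟩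
  -- The constant terms agree because `1 + κ p = p α₊² = α₊ / α₋`, by `p α₊ α₋ = 1`.
  have hκB : κ • B = (αp / αm) • F.delta U ρ αm - Δ := by
    have h1 : αp / αm * αm = αp := div_mul_cancel₀ _ hαm
    have h2 : αp / αm = p * αp ^ 2 := by
      field_simp
      linear_combination -hprod
    have h3 : αp / αm * αm ^ 2 = αp * αm := by
      rw [sq, ← mul_assoc, h1]
    have h4 : κ * p = αp / αm - 1 := by
      rw [h2, hκ]
      linear_combination -hprod
    rw [hB, branchCount, hΔ, delta, delta, smul_add, smul_sub, smul_sub, smul_smul, smul_smul,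
      smul_smul, h1, h3, h4, hκ]
    module
  have hsolve : ∀ a b : F.boundary → v, ∀ f : F.verts → v, F.boundaryRestrict v f = a - b →
      (F.hecke U ρ f + B (αp • F.boundaryExtend v a - αm • F.boundaryExtend v b)
        = ((p : ℂ) + 1 + lam) • f ↔ Δ f = N b) := by
    intro a b f hf
    have h1 : B (F.boundaryExtend v a) = B f + B (F.boundaryExtend v b) := by
      rw [hB, ← branchCount_boundaryExtend_boundaryRestrict hval f, ← map_add, ← map_add, hf,
        sub_add_cancel]
    have h2 : αp • (F.hecke U ρ f + B (αp • F.boundaryExtend v a - αm • F.boundaryExtend v b)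
        - ((p : ℂ) + 1 + lam) • f) = N b - Δ f := by
      have h3 : B f = (p : ℂ) • f - F.Q v f := rfl
      have h4 : Δ f = f - αp • F.hecke U ρ f + αp ^ 2 • F.Q v f := rfl
      have h5 : N b = κ • B (F.boundaryExtend v b) := rfl
      -- The term `f` of `Δ f` is rewritten with coefficient `p α₊ α₋`, after which the identity
      -- holds formally in `p`, `α₊`, `α₋`.
      have h6 : f = (p * αp * αm) • f := by rw [hprod, one_smul]
      rw [map_sub, LinearMap.map_smul, LinearMap.map_smul, h1, h4, h5, ← hsum, hκ, h3]
      conv_rhs => rw [show f - αp • F.hecke U ρ f + αp ^ 2 • F.Q v f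
        = (p * αp * αm) • f - αp • F.hecke U ρ f + αp ^ 2 • F.Q v f by rw [← h6]]
      module
    rw [← sub_eq_zero, ← smul_eq_zero_iff_right hαp, h2, sub_eq_zero, eq_comm]
  refine ⟨LinearMap.id + F.boundaryRestrict v ∘ₗ Δi ∘ₗ N, fun a b => ?_, ?_⟩
  · rw [hF.isScatteringSolution_iff hconn hval hU hp hm]
    have hS : (LinearMap.id + F.boundaryRestrict v ∘ₗ Δi ∘ₗ N :
        (F.boundary → v) →ₗ[ℂ] (F.boundary → v)) b = b + F.boundaryRestrict v (Δi (N b)) := rfl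
    rw [hS]
    constructor
    · rintro ⟨f, hf, heq⟩
      have h1 : f = Δi (N b) := by
        rw [← (hsolve a b f hf).1 heq]
        exact (LinearMap.congr_fun hΔ2 f).symm
      rw [← h1, hf, add_sub_cancel]
    · intro ha
      have hf : F.boundaryRestrict v (Δi (N b)) = a - b := by rw [ha, add_sub_cancel_left]
      exact ⟨_, hf, (hsolve a b _ hf).2 (LinearMap.congr_fun hΔ1 (N b))⟩
  -- Sylvester's identity moves the restriction to the other side, where it meets `N` and leaves `κ
  -- B` on the vertices of `F`.
  · have h1 : LinearMap.det (LinearMap.id + F.boundaryRestrict v ∘ₗ Δi ∘ₗ N)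
        = LinearMap.det (LinearMap.id + (Δi ∘ₗ N) ∘ₗ F.boundaryRestrict v) := by
      have := LinearMap.det_id_sub_comp_comm (-(Δi ∘ₗ N)) (F.boundaryRestrict v)
      rw [LinearMap.comp_neg, LinearMap.neg_comp, sub_neg_eq_add, sub_neg_eq_add] at this
      exact this.symm
    have h2 : N ∘ₗ F.boundaryRestrict v = κ • B := by
      refine LinearMap.ext fun f => ?_
      change κ • B (F.boundaryExtend v (F.boundaryRestrict v f)) = κ • B f
      rw [hB, branchCount_boundaryExtend_boundaryRestrict hval]
    have h3 : Δ ∘ₗ (LinearMap.id + (Δi ∘ₗ N) ∘ₗ F.boundaryRestrict v)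
        = (αp / αm) • F.delta U ρ αm := by
      rw [LinearMap.comp_add, LinearMap.comp_id, LinearMap.comp_assoc, h2, ← LinearMap.comp_assoc,
        hΔ1, LinearMap.id_comp, hκB, add_sub_cancel]
    have h4 := congrArg LinearMap.det h3
    rw [LinearMap.det_comp, LinearMap.det_smul] at h4
    rw [h1, ← mul_div_assoc, eq_div_iff hdet, mul_comm, h4, r0]

end FinSubgraph

end OrientedGraph

end ScatteringOperator

/-! ### The main theorem. -/

theorem theorem2 {X A v : Type*} [Group A] [AddCommGroup v] [Module ℂ v] [FiniteDimensional ℂ v]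
    (p : ℕ) (hp : 1 ≤ p)
    (D : SimpleGraph X) [D.LocallyFinite] (hD : D.IsTree) (hreg : D.IsRegularOfDegree (p + 1))
    (Γ : Subgroup (D ≃g D)) (hΓ : ActsFreely Γ)
    (F : (factorizedTree Γ hΓ).FinSubgraph) (hF : F.IsReducedGraph)
    (U : Quotient (edgeSetoid Γ) → A)
    (hU : ∀ e, U ((factorizedTree Γ hΓ).rev e) = (U e)⁻¹)
    (ρ : Representation ℂ A v) :
    {u : ℂ | LinearMap.det (F.delta U ρ u) = 0}.Finite ∧
    (∃! L : RatFunc ℂ, (factorizedTree Γ hΓ).IsLFunction U ρ L) ∧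
    ∀ lam αp αm : ℂ,
      (∀ z : ℂ, p * z ^ 2 - (p + 1 + lam) * z + 1 = p * (z - αp) * (z - αm)) →
      LinearMap.det (F.delta U ρ αp) ≠ 0 →
      ∃ S : (F.boundary → v) →ₗ[ℂ] (F.boundary → v),
        (∀ a b : F.boundary → v, F.IsScatteringSolution U ρ lam αp αm a b ↔ a = S b) ∧
        LinearMap.det S = (αp / αm) ^ F.r0 v *
          (LinearMap.det (F.delta U ρ αm) / LinearMap.det (F.delta U ρ αp)) ∧
        (LinearMap.det (F.delta U ρ αm) ≠ 0 →
          ∃ R : (F.boundary → v) →ₗ[ℂ] (F.boundary → v),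
            R ∘ₗ S = LinearMap.id ∧ S ∘ₗ R = LinearMap.id ∧
            (∀ a b : F.boundary → v, F.IsScatteringSolution U ρ lam αp αm a b ↔ b = R a) ∧
            (αp ^ 2 ≠ 1 → αm ^ 2 ≠ 1 →
              ∀ L : RatFunc ℂ, (factorizedTree Γ hΓ).IsLFunction U ρ L →
                LinearMap.det S = (αp / αm) ^ F.r0 v *
                  ((1 - αm ^ 2) / (1 - αp ^ 2)) ^ ((F.r0 v : ℤ) - (F.r1 v : ℤ)) *
                  (L.eval (RingHom.id ℂ) αp / L.eval (RingHom.id ℂ) αm))) := by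
  have hval := factorizedTree_valency hreg hΓ
  have hconn := factorizedTree_connected hD.connected hΓ
  obtain ⟨L₀, hL₀, heval⟩ := hF.exists_isLFunction ρ hU
  refine ⟨F.finite_setOf_det_delta_eq_zero ρ U, ⟨L₀, hL₀, fun L hL => hL.unique hL₀⟩, ?_⟩
  intro lam αp αm hα hdetp
  -- Vieta's relations, read off from the factorization at `z = 0` and `z = 1`.
  have hprod : (p : ℂ) * αp * αm = 1 := by
    linear_combination -hα 0
  have hsum : (p : ℂ) * (αp + αm) = p + 1 + lam := by
    linear_combination hα 1 - hα 0
  obtain ⟨S, hS, hdetS⟩ := hF.exists_scattering_operator hconn hval hU hprod hsum hdetp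
  refine ⟨S, hS, hdetS, fun hdetm => ?_⟩
  obtain ⟨R, hR, -⟩ := hF.exists_scattering_operator (lam := lam) (αp := αm) (αm := αp) hconn hval
    hU (by linear_combination hprod) (by linear_combination hsum) hdetm
  have hR' : ∀ a b : F.boundary → v, F.IsScatteringSolution U ρ lam αp αm a b ↔ b = R a := by
    intro a b
    rw [OrientedGraph.FinSubgraph.isScatteringSolution_swap, hR, map_neg, neg_inj]
  refine ⟨R, ?_, ?_, hR', fun hp1 hm1 L hL => ?_⟩
  · exact LinearMap.ext fun b => ((hR' _ _).1 ((hS (S b) b).2 rfl)).symm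
  · exact LinearMap.ext fun a => ((hS _ _).1 ((hR' a (R a)).2 rfl)).symm
  · rw [hL.unique hL₀, heval αp hp1 hdetp, heval αm hm1 hdetm, hdetS]
    have h1 : 1 - αp ^ 2 ≠ 0 := sub_ne_zero.2 hp1.symm
    have h2 : 1 - αm ^ 2 ≠ 0 := sub_ne_zero.2 hm1.symm
    rw [zpow_sub₀ (div_ne_zero h2 h1), zpow_natCast, zpow_natCast, div_pow (1 - αm ^ 2),
      div_pow (1 - αm ^ 2), mul_assoc]
    congr 1
    field_simp
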